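/- A \emph{concrete site} $(\mathbb C,J)$ is a small category $\mathbb C$ with a terminal object $\star$ and an initial object $0$ such that $|{-}|:=\mathbb C(\star,-):\mathbb C\to\mathsf{Set}$ is faithful, with a coverage $J$, i.e. sets $J(c)$ of covering families $\{f_i:c_i\to c\}_{i\in I}$ such that: (C) if $h:d\to c$ and $\{f_i\}\in J(c)$, there is $\{g_j\}\in J(d)$ such that every $h\circ g_j$ factors through some $f_i$; ($\star$) every $\{f_i\}\in J(c)$ satisfies $\bigcup_i\mathrm{Im}|f_i|=|c|$; ($0$) the empty family covers $0$; (M) every $\{1_c\}$ is covering; (L) composing a covering family with covering families of the domains of its members gives a covering family. Let $\mathcal M$ be a class of monos of $\mathbb C$ that contains the isomorphisms, is closed under composition, and all of whose pullbacks along arbitrary maps exist and lie in $\mathcal M$. Let $\Delta_{\mathcal M}(c)$ be the set of subobjects of $c$ represented by members of $\mathcal M$ ($\mathcal M$-subobjects), a presheaf under pullback. $\mathcal M$ is a \emph{class of admissible monos} for a concrete site $(\mathbb C,J)$ if (i) $\Delta_{\mathcal M}$ is a $J$-sheaf; (ii) every map $0\to c$ is in $\mathcal M$; (iii) for $m,m'\in\mathcal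 M$ with codomain $c$, $\mathrm{Im}|m|\subseteq\mathrm{Im}|m'|$ implies $m\le m'$ as subobjects; (iv) for every increasing sequence $(m_n:c_n\rightarrowtail c)_{n\in\mathbb N}$ of $\mathcal M$-subobjects there is an $\mathcal M$-subobject $m_\infty:c_\infty\rightarrowtail c$ with $\mathrm{Im}|m_\infty|=\bigcup_n\mathrm{Im}|m_n|$; (v) in (iv), $c_\infty$ has a covering family each of whose members factors through some $c_n\rightarrowtail c_\infty$. Let $\mathbb V_0$ be the full subcategory of $\omega$-cpos and $\omega$-continuous maps on $\mathrm V=\omega+1=\mathbb N\cup\{\infty\}$, the terminal object and the initial object. Let $J_{\mathrm V}$ consist of the singleton families $\{1_{\mathrm V}\}$, $\{1_\star\}$, $\{1_0\}$ and the empty family on $0$, and let $\mathcal M_{\mathrm V}$ consist of the maps $x\mapsto x+n$ on $\mathrm V$ ($n\in\mathbb N$), the identities of $\star$ and $0$, and the maps $0\to\mathrm V$, $0\to\star$. Let $\mathbb C+\mathbb V_0$ be the category obtained from $\mathbb C$ and $\mathbb V_0$ by identifying the terminal objects and the initial objects and adding all constant maps (as functions on points) between $\mathrm V$ and objects of $\mathbb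 C$, and equip it with the coverage $J\cup J_{\mathrm V}$ and the class $\mathcal M\cup\mathcal M_{\mathrm V}$, closed under isomorphism of subobjects. In the sheaf topos $\mathcal E=\mathsf{Sh}(\mathbb C+\mathbb V_0,J\cup J_{\mathrm V})$, let $\Delta=\Delta_{\mathcal M\cup\mathcal M_{\mathrm V}}$, and let $L$ be the lifting functor, $L(X)(c)=\coprod_{(m:c'\rightarrowtail c)}X(c')$, the coproduct over the $(\mathcal M\cup\mathcal M_{\mathrm V})$-subobjects $m$ of $c$, with restriction along $f:d\to c$ given by pulling $m$ back along $f$ and restricting the element. Let $\bot:1\to L1$ pick out the subobjects $0\rightarrowtail c$, let $\omega$ be the colimit in $\mathcal E$ of $1\xrightarrow{\bot}L1\xrightarrow{L\bot}L^21\to\cdots$, let $\bar\omega$ be the limit of $1\xleftarrow{!}L1\xleftarrow{L!}L^21\leftarrow\cdots$, and let $i:\omega\to\bar\omega$ be the comparison map, i.e. the map whose composite $L^n1\to\omega\to\bar\omega\to L^n1$ is the identity for every $n$. A sheaf $X\in\mathcal E$ is \emph{$L$-complete} if for every $A\in\mathcal E$ every map $\omega\times A\to X$ factors uniquely through $i\times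 1_A:\omega\times A\to\bar\omega\times A$ (equivalently, $X^i:X^{\bar\omega}\to X^\omega$ is an isomorphism). \textbf{Proposition.} Let $(\mathbb C,J)$ be a concrete site and $\mathcal M$ a class of admissible monos for it. Then $\Delta$ and $L\bigl(\coprod_{n\in\mathbb N}1\bigr)$ are $L$-complete objects of $\mathcal E$. -/

import Mathlib

open CategoryTheory Limits Opposite

universe u

namespace SDT

section Subobjects

variable {C : Type u} [SmallCategory C]

/-- A class of monomorphisms of `C` that contains all isomorphisms, is closed under composition,
and all of whose pullbacks exist and lie in the class again. -/
structure StableMonos (M : MorphismProperty C) : Prop where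
  mono : ∀ {c d : C} (m : c ⟶ d), M m → Mono m
  iso : ∀ {c d : C} (m : c ⟶ d), IsIso m → M m
  comp : ∀ {b c d : C} (m : b ⟶ c) (n : c ⟶ d), M m → M n → M (m ≫ n)
  pullback : ∀ {b c d : C} (m : b ⟶ c) (f : d ⟶ c), M m →
    ∃ (e : C) (g : e ⟶ b) (n : e ⟶ d), M n ∧ IsPullback g n m f

/-- The sieve of all morphisms into `c` that factor through `m`. For monos it determines and is
determined by the subobject `[m]`, see `sieveOf_eq_iff`; the order of subobjects is inclusion of
sieves, see `sieveOf_le_iff`. -/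
def sieveOf {b c : C} (m : b ⟶ c) : Sieve c where
  arrows d f := ∃ g : d ⟶ b, g ≫ m = f
  downward_closed := by
    rintro d e f ⟨g, rfl⟩ h
    exact ⟨h ≫ g, by simp⟩

theorem sieveOf_le_iff {b b' c : C} (m : b ⟶ c) (m' : b' ⟶ c) :
    sieveOf m ≤ sieveOf m' ↔ ∃ f : b ⟶ b', f ≫ m' = m := by
  constructor
  · intro h
    exact h m ⟨𝟙 b, by simp⟩
  · rintro ⟨f, rfl⟩ d g ⟨h, rfl⟩
    exact ⟨h ≫ f, by simp⟩

theorem sieveOf_eq_iff {b b' c : C} (m : b ⟶ c) (m' : b' ⟶ c) [Mono m] [Mono m'] :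
    sieveOf m = sieveOf m' ↔ Subobject.mk m = Subobject.mk m' := by
  constructor
  · intro h
    obtain ⟨f, hf⟩ := (sieveOf_le_iff m m').1 h.le
    obtain ⟨g, hg⟩ := (sieveOf_le_iff m' m).1 h.ge
    exact le_antisymm (Subobject.mk_le_mk_of_comm f hf) (Subobject.mk_le_mk_of_comm g hg)
  · intro h
    exact le_antisymm
      ((sieveOf_le_iff m m').2 ⟨Subobject.ofMkLEMk m m' h.le, Subobject.ofMkLEMk_comp _⟩)
      ((sieveOf_le_iff m' m).2 ⟨Subobject.ofMkLEMk m' m h.ge, Subobject.ofMkLEMk_comp _⟩)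

/-- `U` represents an `M`-subobject of `c`, i.e. it consists of the morphisms that factor through
some member `m` of `M`. So `{U // IsSub M U}` is the set of `M`-subobjects of `c`. -/
def IsSub (M : MorphismProperty C) {c : C} (U : Sieve c) : Prop :=
  ∃ (b : C) (m : b ⟶ c), M m ∧ U = sieveOf m

theorem IsSub.pullback {M : MorphismProperty C} (hM : StableMonos M) {c d : C} {U : Sieve c}
    (hU : IsSub M U) (f : d ⟶ c) : IsSub M (U.pullback f) := by
  obtain ⟨b, m, hm, rfl⟩ := hU
  obtain ⟨e, g, n, hn, h⟩ := hM.pullback m f hm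
  refine ⟨e, n, hn, ?_⟩
  ext x k
  constructor
  · rintro ⟨l, hl⟩
    exact ⟨h.lift l k hl, by simp⟩
  · rintro ⟨l, rfl⟩
    exact ⟨l ≫ g, by simp [h.w]⟩

/-- The presheaf of `M`-subobjects; restriction is pullback of subobjects. -/
def Delta (M : MorphismProperty C) (hM : StableMonos M) : Cᵒᵖ ⥤ Type u where
  obj c := {U : Sieve c.unop // IsSub M U}
  map f := ↾ fun U => ⟨U.1.pullback f.unop, U.2.pullback hM f.unop⟩
  map_id c := by
    apply ConcreteCategory.hom_ext
    intro U
    exact Subtype.ext Sieve.pullback_id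
  map_comp f g := by
    apply ConcreteCategory.hom_ext
    intro U
    exact Subtype.ext (Sieve.pullback_comp _)

/-- A class of pre-admissible monos for a site `(C, J)`: moreover the presheaf of `M`-subobjects
is a `J`-sheaf. -/
structure PreAdmissible (J : Coverage C) (M : MorphismProperty C) : Prop
    extends StableMonos M where
  sheaf : ∀ (c : C) (R : Presieve c), R ∈ J c → R.IsSheafFor (Delta M toStableMonos)

/-- The dominance `Δ_M` as an object of the sheaf topos. -/
def deltaSheaf {J : Coverage C} {M : MorphismProperty C} (hM : PreAdmissible J M) :
    Sheaf J.toGrothendieck (Type u) where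
  obj := Delta M hM.toStableMonos
  property := by
    rw [isSheaf_iff_isSheaf_of_type, Presieve.isSheaf_coverage]
    exact fun R hR => hM.sheaf _ R hR

/-- A section over `c` of the lifting of `X`: an `M`-subobject of `c`, together with an element of
`X` over its domain. The latter is given as a matching family of elements of `X` on the sieve of
morphisms that factor through the subobject, which is the same thing, see
`PartialSection.equivOfMono`. -/
structure PartialSection (M : MorphismProperty C) (X : Cᵒᵖ ⥤ Type u) (c : C) where
  dom : Sieve c
  isSub : IsSub M dom
  val : ∀ ⦃d : C⦄ (f : d ⟶ c), dom f → X.obj (op d)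
  compat : ∀ ⦃d e : C⦄ (f : d ⟶ c) (g : e ⟶ d) (hf : dom f),
    val (g ≫ f) (dom.downward_closed hf g) = X.map g.op (val f hf)

namespace PartialSection

variable {M : MorphismProperty C} {X Y Z : Cᵒᵖ ⥤ Type u} {c d e : C}

theorem ext' {s t : PartialSection M X c} (h : s.dom = t.dom)
    (h' : ∀ ⦃d : C⦄ (f : d ⟶ c) (hs : s.dom f) (ht : t.dom f), s.val f hs = t.val f ht) :
    s = t := by
  obtain ⟨U, hU, v, hv⟩ := s
  obtain ⟨U', hU', v', hv'⟩ := t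
  obtain rfl : U = U' := h
  obtain rfl : v = v' := by
    funext d f hf
    exact h' f hf hf
  rfl

theorem val_congr (s : PartialSection M X c) {f g : d ⟶ c} (h : f = g) (hf : s.dom f)
    (hg : s.dom g) : s.val f hf = s.val g hg := by
  subst h; rfl

/-- Restriction along `f : d ⟶ c`: pull the subobject back, and restrict the element to it. -/
def restrict (hM : StableMonos M) (s : PartialSection M X c) (f : d ⟶ c) :
    PartialSection M X d where
  dom := s.dom.pullback f
  isSub := s.isSub.pullback hM f
  val _ g hg := s.val (g ≫ f) hg
  compat x e g h hg := by
    refine Eq.trans ?_ (s.compat (g ≫ f) h hg)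
    exact s.val_congr (by simp) _ _

/-- Functoriality of the lifting in the sheaf. -/
def map (φ : X ⟶ Y) (s : PartialSection M X c) : PartialSection M Y c where
  dom := s.dom
  isSub := s.isSub
  val _ f hf := φ.app _ (s.val f hf)
  compat _ _ f g hf := by
    rw [s.compat]
    exact NatTrans.naturality_apply φ g.op _

/-- The partial sections whose domain is the subobject `[m]`, for `m : b ⟶ c` in `M`, are the
elements of `X` over `b`: the lifting at `c` is the coproduct, over the `M`-subobjects of `c`, of
the values of `X` at their domains. -/
noncomputable def equivOfMono {b : C} (m : b ⟶ c) [Mono m] (hm : M m) :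
    {s : PartialSection M X c // s.dom = sieveOf m} ≃ X.obj (op b) where
  toFun s := s.1.val m (by rw [s.2]; exact ⟨𝟙 b, by simp⟩)
  invFun x := ⟨{ dom := sieveOf m
                 isSub := ⟨b, m, hm, rfl⟩
                 val := fun d f hf => X.map hf.choose.op x
                 compat := by
                  intro d e f g hf
                  have hgf : ∃ k : e ⟶ b, k ≫ m = g ≫ f := (sieveOf m).downward_closed hf g
                  have h : hgf.choose = g ≫ hf.choose := by
                    rw [← cancel_mono m, hgf.choose_spec, Category.assoc, hf.choose_spec]
                  change X.map hgf.choose.op x = _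
                  rw [h, op_comp]
                  exact Functor.map_comp_apply X _ _ x }, rfl⟩
  left_inv := by
    rintro ⟨s, hs⟩
    refine Subtype.ext (ext' hs.symm fun d f hf hf' => ?_)
    have hk : ∃ k : d ⟶ b, k ≫ m = f := hf
    have hm' : s.dom m := by rw [hs]; exact ⟨𝟙 b, by simp⟩
    refine (s.compat m hk.choose hm').symm.trans ?_
    exact s.val_congr hk.choose_spec _ _
  right_inv x := by
    have hk : ∃ k : b ⟶ b, k ≫ m = m := ⟨𝟙 b, by simp⟩
    have h : hk.choose = 𝟙 b := by
      rw [← cancel_mono m, hk.choose_spec, Category.id_comp]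
    change X.map hk.choose.op x = x
    rw [h]
    simp

end PartialSection

/-- The presheaf underlying the lifting of `X`. -/
def liftPresheaf {M : MorphismProperty C} (hM : StableMonos M) (X : Cᵒᵖ ⥤ Type u) :
    Cᵒᵖ ⥤ Type u where
  obj c := PartialSection M X c.unop
  map f := ↾ fun s => s.restrict hM f.unop
  map_id c := by
    apply ConcreteCategory.hom_ext
    intro s
    apply PartialSection.ext'
    · exact Sieve.pullback_id
    · intro d f hs ht
      exact s.val_congr (by simp) _ _
  map_comp f g := by
    apply ConcreteCategory.hom_ext
    intro s
    apply PartialSection.ext'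
    · exact Sieve.pullback_comp _
    · intro d f hs ht
      exact s.val_congr (by simp) _ _

theorem liftPresheaf_isSheaf {J : Coverage C} {M : MorphismProperty C} (hM : PreAdmissible J M)
    (X : Sheaf J.toGrothendieck (Type u)) :
    Presheaf.IsSheaf J.toGrothendieck (liftPresheaf hM.toStableMonos X.obj) := by
  have hX : Presieve.IsSheaf J.toGrothendieck X.obj :=
    (isSheaf_iff_isSheaf_of_type _ _).1 X.property
  have hD : Presieve.IsSheaf J.toGrothendieck (Delta M hM.toStableMonos) :=
    (isSheaf_iff_isSheaf_of_type _ _).1 (deltaSheaf hM).property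
  rw [isSheaf_iff_isSheaf_of_type]
  intro c R hR
  rw [← Presieve.isSeparatedFor_and_exists_isAmalgamation_iff_isSheafFor]
  constructor
  · intro x s t hs ht
    have hdom : s.dom = t.dom := by
      have := (hD R hR).isSeparatedFor (fun d f hf => ⟨(x f hf).dom, (x f hf).isSub⟩)
        ⟨s.dom, s.isSub⟩ ⟨t.dom, t.isSub⟩
        (fun d f hf => Subtype.ext (congrArg PartialSection.dom (hs f hf)))
        (fun d f hf => Subtype.ext (congrArg PartialSection.dom (ht f hf)))
      exact congrArg Subtype.val this
    refine PartialSection.ext' hdom fun d f hf hf' => ?_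
    refine (hX _ (J.toGrothendieck.pullback_stable f hR)).isSeparatedFor.ext fun e g hg => ?_
    rw [← s.compat, ← t.compat]
    have h1 : s.restrict hM.toStableMonos (g ≫ f) = t.restrict hM.toStableMonos (g ≫ f) :=
      (hs (g ≫ f) hg).trans (ht (g ≫ f) hg).symm
    have key : ∀ (a b : PartialSection M X.obj e) (h : a = b) (ha : a.dom (𝟙 e))
        (hb : b.dom (𝟙 e)), a.val (𝟙 e) ha = b.val (𝟙 e) hb := by
      rintro a _ rfl ha hb; rfl
    have h2 := key _ _ h1
      (by change s.dom _; rw [Category.id_comp]; exact s.dom.downward_closed hf g)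
      (by change t.dom _; rw [Category.id_comp]; exact t.dom.downward_closed hf' g)
    have e1 := s.val_congr (Category.id_comp (g ≫ f))
      (by rw [Category.id_comp]; exact s.dom.downward_closed hf g) (s.dom.downward_closed hf g)
    have e2 := t.val_congr (Category.id_comp (g ≫ f))
      (by rw [Category.id_comp]; exact t.dom.downward_closed hf' g) (t.dom.downward_closed hf' g)
    exact e1.symm.trans (h2.trans e2)
  · intro x hx
    rw [Presieve.compatible_iff_sieveCompatible] at hx
    have hx' : ∀ ⦃d e : C⦄ (f : d ⟶ c) (g : e ⟶ d) (hf : R f),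
        x (g ≫ f) (R.downward_closed hf g) = (x f hf).restrict hM.toStableMonos g := by
      intro d e f g hf
      exact hx f g hf
    obtain ⟨U, hU, -⟩ := hD R hR (fun d f hf => ⟨(x f hf).dom, (x f hf).isSub⟩) (by
      refine (Presieve.compatible_iff_sieveCompatible _).2 ?_
      intro d e f g hf
      exact Subtype.ext (congrArg PartialSection.dom (hx' f g hf)))
    have hU' : ∀ ⦃d : C⦄ (f : d ⟶ c) (hf : R f), U.1.pullback f = (x f hf).dom :=
      fun d f hf => congrArg Subtype.val (hU f hf)
    have mem : ∀ ⦃d e : C⦄ (f : d ⟶ c) (g : e ⟶ d) (hR : R (g ≫ f)) (hf : U.1 f),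
        (x (g ≫ f) hR).dom (𝟙 e) := by
      intro d e f g hR hf
      rw [← hU']
      change U.1 _
      rw [Category.id_comp]
      exact U.1.downward_closed hf g
    have valeq : ∀ ⦃e : C⦄ (a b : PartialSection M X.obj e) (h : a = b)
        {d : C} (f g : d ⟶ e) (hfg : f = g) (ha : a.dom f)
        (hb : b.dom g), a.val f ha = b.val g hb := by
      rintro e a _ rfl d f _ rfl ha hb; rfl
    have fam : ∀ ⦃d : C⦄ (f : d ⟶ c) (hf : U.1 f), ∃! t : X.obj.obj (op d),
        ∀ ⦃e : C⦄ (g : e ⟶ d) (hg : R (g ≫ f)),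
          X.obj.map g.op t = (x (g ≫ f) hg).val (𝟙 e) (mem f g hg hf) := by
      intro d f hf
      refine hX _ (J.toGrothendieck.pullback_stable f hR)
        (fun e g hg => (x (g ≫ f) hg).val (𝟙 e) (mem f g hg hf)) ?_
      refine (Presieve.compatible_iff_sieveCompatible _).2 ?_
      intro e e' g k hg
      have hh : (x (g ≫ f) hg).dom (k ≫ 𝟙 e) :=
        (x (g ≫ f) hg).dom.downward_closed (mem f g hg hf) k
      refine Eq.trans ?_ ((x (g ≫ f) hg).compat (𝟙 e) k (mem f g hg hf))
      have h1 := hx' (g ≫ f) k hg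
      have hc : ∀ (a : e' ⟶ c) (ha : R a) (hab : a = k ≫ g ≫ f) (ha' : (x a ha).dom (𝟙 e')),
          (x a ha).val (𝟙 e') ha' = (x (g ≫ f) hg).val (k ≫ 𝟙 e) hh := by
        rintro a ha rfl ha'
        have hm : ((x (g ≫ f) hg).restrict hM.toStableMonos k).dom (𝟙 e') := h1 ▸ ha'
        refine (valeq _ _ h1 _ _ rfl ha' hm).trans ?_
        exact (x (g ≫ f) hg).val_congr (by simp) _ _
      exact hc _ _ (by simp) _
    choose v hv hvu using fam
    refine ⟨⟨U.1, U.2, v, ?_⟩, ?_⟩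
    · intro d e f g hf
      symm
      apply hvu (g ≫ f)
      intro e' k hk
      have hk' : R ((k ≫ g) ≫ f) := by simpa using hk
      have h3 := hv f hf (k ≫ g) hk'
      rw [op_comp, Functor.map_comp_apply] at h3
      rw [h3]
      have : ∀ (a b : e' ⟶ c) (hab : a = b) (ha : R a) (hb : R b) (h1 : (x a ha).dom (𝟙 e'))
          (h2 : (x b hb).dom (𝟙 e')), (x a ha).val (𝟙 e') h1 = (x b hb).val (𝟙 e') h2 := by
        rintro a _ rfl ha hb h1 h2; rfl
      exact this _ _ (by simp) _ _ _ _
    · intro d f hf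
      refine PartialSection.ext' (hU' f hf) fun e g hg hg' => ?_
      change v (g ≫ f) hg = _
      symm
      apply hvu
      intro e' k hk
      rw [← (x f hf).compat]
      have h1 := hx' f (k ≫ g) hf
      have : ∀ (a : e' ⟶ c) (ha : R a) (hab : a = (k ≫ g) ≫ f) (ha' : (x a ha).dom (𝟙 e')),
          (x f hf).val (k ≫ g) ((x f hf).dom.downward_closed hg' k) = (x a ha).val (𝟙 e') ha' := by
        rintro a ha rfl ha'
        have hm : ((x f hf).restrict hM.toStableMonos (k ≫ g)).dom (𝟙 e') := h1 ▸ ha'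
        refine Eq.trans ?_ (valeq _ _ h1 _ _ rfl ha' hm).symm
        exact (x f hf).val_congr (by simp) _ _
      exact this _ _ (by simp) _

/-- The lifting functor `L_M` on the sheaf topos. -/
def lift {J : Coverage C} {M : MorphismProperty C} (hM : PreAdmissible J M) :
    Sheaf J.toGrothendieck (Type u) ⥤ Sheaf J.toGrothendieck (Type u) where
  obj X := ⟨liftPresheaf hM.toStableMonos X.obj, liftPresheaf_isSheaf hM X⟩
  map φ := ⟨{ app := fun c => ↾ fun s => s.map φ.hom
              naturality := by
                intro c d f
                ext s
                rfl }⟩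
  map_id X := by
    apply Sheaf.hom_ext
    ext c s
    exact PartialSection.ext' rfl fun d f _ _ => rfl
  map_comp φ ψ := by
    apply Sheaf.hom_ext
    ext c s
    exact PartialSection.ext' rfl fun d f _ _ => rfl

end Subobjects


/-- A concrete site: a small category with a terminal object `star` and an initial object `zero`
such that `C(star, -)` is faithful, with a coverage (Mathlib's `Coverage` contains the stability
axiom (C)) that satisfies the axioms (⋆), (0), (M) and (L), in this order. A covering family is
recorded by the set of its members, on which alone the notion of sheaf depends. -/
structure ConcreteSite (C : Type u) [SmallCategory C] where
  star : C
  starTerminal : IsTerminal star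
  zero : C
  zeroInitial : IsInitial zero
  faithful : (coyoneda.obj (op star)).Faithful
  cov : Coverage C
  cov_points : ∀ (c : C) (R : Presieve c), R ∈ cov c → ∀ p : star ⟶ c,
    ∃ (d : C) (f : d ⟶ c) (q : star ⟶ d), R f ∧ q ≫ f = p
  cov_zero : (⊥ : Presieve zero) ∈ cov zero
  cov_id : ∀ c : C, Presieve.singleton (𝟙 c) ∈ cov c
  cov_bind : ∀ (c : C) (R : Presieve c) (T : ∀ ⦃d : C⦄ ⦃f : d ⟶ c⦄, R f → Presieve d),
    R ∈ cov c → (∀ ⦃d : C⦄ ⦃f : d ⟶ c⦄ (hf : R f), T hf ∈ cov d) → R.bind T ∈ cov c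

namespace ConcreteSite

variable {C : Type u} [SmallCategory C] (S : ConcreteSite C)

/-- The set of points of `c` that factor through `m`. -/
def image {b c : C} (m : b ⟶ c) : Set (S.star ⟶ c) := Set.range fun q : S.star ⟶ b => q ≫ m

theorem hom_ext {c d : C} (f g : c ⟶ d) (h : ∀ p : S.star ⟶ c, p ≫ f = p ≫ g) : f = g := by
  have := S.faithful
  apply (coyoneda.obj (op S.star)).map_injective
  apply ConcreteCategory.hom_ext
  intro p
  exact h p

theorem no_points_zero (p : S.star ⟶ S.zero) : False := by
  obtain ⟨d, f, q, hf, -⟩ := S.cov_points _ _ S.cov_zero p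
  exact hf

theorem hom_ext_zero {c d : C} (k : c ⟶ S.zero) (f g : c ⟶ d) : f = g :=
  S.hom_ext _ _ fun p => (S.no_points_zero (p ≫ k)).elim

theorem bot_mem {d : C} (k : d ⟶ S.zero) : (⊥ : Sieve d) ∈ S.cov.toGrothendieck d := by
  have h : (⊥ : Sieve S.zero) ∈ S.cov.toGrothendieck S.zero := by
    have h := Coverage.Saturate.of (K := S.cov) _ _ S.cov_zero
    have e : Sieve.generate (⊥ : Presieve S.zero) = ⊥ := by
      ext e g
      simp [Sieve.generate]
    rw [e] at h
    exact h
  have := S.cov.toGrothendieck.pullback_stable k h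
  simpa using this

theorem exists_unique_section {d : C} (k : d ⟶ S.zero)
    (X : Sheaf S.cov.toGrothendieck (Type u)) : Nonempty (Unique (X.obj.obj (op d))) :=
  ⟨Types.isTerminalEquivUnique _ (Sheaf.isTerminalOfBotCover X d (S.bot_mem k))⟩

end ConcreteSite

/-- A class of admissible monos on a concrete site: a class of pre-admissible monos such that all
maps `zero ⟶ c` are in `M`; `M`-subobjects are ordered by inclusion of their sets of points (hence
are determined by these); for an increasing chain of `M`-subobjects of `c`, the union of the sets
of points is the set of points of an `M`-subobject `m' : b' ⟶ c`; and then `b'` has a covering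
family each of whose members factors through the inclusion into `b'` of some member of the chain. -/
structure Admissible {C : Type u} [SmallCategory C] (S : ConcreteSite C)
    (M : MorphismProperty C) : Prop extends PreAdmissible S.cov M where
  zero_mem : ∀ c : C, M (S.zeroInitial.to c)
  reflects : ∀ {b b' c : C} (m : b ⟶ c) (m' : b' ⟶ c), M m → M m' →
    S.image m ⊆ S.image m' → ∃ f : b ⟶ b', f ≫ m' = m
  chain_sup : ∀ (c : C) (b : ℕ → C) (m : ∀ n, b n ⟶ c), (∀ n, M (m n)) →
    (∀ n, ∃ f : b n ⟶ b (n + 1), f ≫ m (n + 1) = m n) →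
    ∃ (b' : C) (m' : b' ⟶ c), M m' ∧ S.image m' = ⋃ n, S.image (m n)
  chain_cover : ∀ (c : C) (b : ℕ → C) (m : ∀ n, b n ⟶ c), (∀ n, M (m n)) →
    (∀ n, ∃ f : b n ⟶ b (n + 1), f ≫ m (n + 1) = m n) →
    ∀ (b' : C) (m' : b' ⟶ c), M m' → S.image m' = ⋃ n, S.image (m n) →
    ∃ R ∈ S.cov b', ∀ ⦃d : C⦄ (f : d ⟶ b'), R f → ∃ (n : ℕ) (k : d ⟶ b n), k ≫ m n = f ≫ m'

section Chains

variable {C : Type u} [SmallCategory C] {S : ConcreteSite C} {M : MorphismProperty C}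

/-- The section with empty domain. -/
noncomputable def botSection (h0 : ∀ c : C, M (S.zeroInitial.to c))
    (X : Sheaf S.cov.toGrothendieck (Type u)) (c : C) : PartialSection M X.obj c where
  dom := sieveOf (S.zeroInitial.to c)
  isSub := ⟨_, _, h0 c, rfl⟩
  val _ _ hf := (S.exists_unique_section hf.choose X).some.default
  compat _ _ _ g hf :=
    ((S.exists_unique_section (g ≫ hf.choose) X).some.eq_default _).trans
      ((S.exists_unique_section (g ≫ hf.choose) X).some.eq_default _).symm

theorem eq_botSection (h0 : ∀ c : C, M (S.zeroInitial.to c))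
    (X : Sheaf S.cov.toGrothendieck (Type u)) {c : C} (s : PartialSection M X.obj c)
    (hs : s.dom = sieveOf (S.zeroInitial.to c)) : s = botSection h0 X c := by
  refine PartialSection.ext' hs fun d f hf hf' => ?_
  exact ((S.exists_unique_section hf'.choose X).some.eq_default _).trans
      ((S.exists_unique_section hf'.choose X).some.eq_default _).symm

/-- The map `⊥ : 1 ⟶ L X`, which picks out the section with empty domain. -/
noncomputable def bot (hM : PreAdmissible S.cov M) (h0 : ∀ c : C, M (S.zeroInitial.to c))
    (X : Sheaf S.cov.toGrothendieck (Type u)) :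
    (⊤_ (Sheaf S.cov.toGrothendieck (Type u))) ⟶ (lift hM).obj X :=
  ⟨{ app := fun c => ↾ fun _ => botSection h0 X c.unop
     naturality := by
      intro c d f
      apply ConcreteCategory.hom_ext
      intro x
      symm
      refine eq_botSection h0 X _ ?_
      change (sieveOf (S.zeroInitial.to c.unop)).pullback f.unop = _
      ext e g
      constructor
      · rintro ⟨k, hk⟩
        exact ⟨k, S.hom_ext_zero k _ _⟩
      · rintro ⟨k, rfl⟩
        exact ⟨k, S.hom_ext_zero k _ _⟩ }⟩

theorem bot_map (hM : PreAdmissible S.cov M) (h0 : ∀ c : C, M (S.zeroInitial.to c))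
    {X Y : Sheaf S.cov.toGrothendieck (Type u)} (φ : X ⟶ Y) :
    bot hM h0 X ≫ (lift hM).map φ = bot hM h0 Y := by
  apply Sheaf.hom_ext
  ext c x
  exact eq_botSection h0 Y _ rfl

/-- The objects `Lⁿ 1`. -/
noncomputable def iter (hM : PreAdmissible S.cov M) :
    ℕ → Sheaf S.cov.toGrothendieck (Type u)
  | 0 => ⊤_ _
  | n + 1 => (lift hM).obj (iter hM n)

/-- The maps `Lⁿ ⊥ : Lⁿ 1 ⟶ Lⁿ⁺¹ 1`. -/
noncomputable def up (hM : PreAdmissible S.cov M) (h0 : ∀ c : C, M (S.zeroInitial.to c)) :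
    ∀ n : ℕ, iter hM n ⟶ iter hM (n + 1)
  | 0 => bot hM h0 (⊤_ _)
  | n + 1 => (lift hM).map (up hM h0 n)

/-- The maps `Lⁿ ! : Lⁿ⁺¹ 1 ⟶ Lⁿ 1`. -/
noncomputable def down (hM : PreAdmissible S.cov M) :
    ∀ n : ℕ, iter hM (n + 1) ⟶ iter hM n
  | 0 => terminal.from _
  | n + 1 => (lift hM).map (down hM n)

/-- The object `ω`, the colimit of `1 ⟶ L 1 ⟶ L L 1 ⟶ ⋯` in the sheaf topos. -/
noncomputable def omega (hM : PreAdmissible S.cov M) (h0 : ∀ c : C, M (S.zeroInitial.to c)) :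
    Sheaf S.cov.toGrothendieck (Type u) :=
  colimit (Functor.ofSequence (up hM h0))

/-- The object `ω̄`, the limit of `1 ⟵ L 1 ⟵ L L 1 ⟵ ⋯` in the sheaf topos. -/
noncomputable def omegaBar (hM : PreAdmissible S.cov M) : Sheaf S.cov.toGrothendieck (Type u) :=
  limit (Functor.ofOpSequence (down hM))

/-- The comparison `Lⁿ 1 ⟶ Lᵐ 1`: a composite of maps `up` for `n ≤ m`, of maps `down` for `n ≥ m`;
see `iterMap_self`, `iterMap_down` and `up_iterMap`, which characterize it. -/
noncomputable def iterMap (hM : PreAdmissible S.cov M) (h0 : ∀ c : C, M (S.zeroInitial.to c)) :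
    ∀ n m : ℕ, iter hM n ⟶ iter hM m
  | _, 0 => terminal.from _
  | 0, m + 1 => bot hM h0 (iter hM m)
  | n + 1, m + 1 => (lift hM).map (iterMap hM h0 n m)

theorem iterMap_down (hM : PreAdmissible S.cov M) (h0 : ∀ c : C, M (S.zeroInitial.to c))
    (n m : ℕ) : iterMap hM h0 n (m + 1) ≫ down hM m = iterMap hM h0 n m := by
  induction m generalizing n with
  | zero => exact terminal.hom_ext _ _
  | succ m ih =>
    cases n with
    | zero => exact bot_map hM h0 (down hM m)
    | succ n => exact ((lift hM).map_comp _ _).symm.trans (congrArg _ (ih n))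

theorem up_iterMap (hM : PreAdmissible S.cov M) (h0 : ∀ c : C, M (S.zeroInitial.to c))
    (n m : ℕ) : up hM h0 n ≫ iterMap hM h0 (n + 1) m = iterMap hM h0 n m := by
  induction m generalizing n with
  | zero => exact terminal.hom_ext _ _
  | succ m ih =>
    cases n with
    | zero => exact bot_map hM h0 _
    | succ n => exact ((lift hM).map_comp _ _).symm.trans (congrArg _ (ih n))

theorem iterMap_self (hM : PreAdmissible S.cov M) (h0 : ∀ c : C, M (S.zeroInitial.to c))
    (n : ℕ) : iterMap hM h0 n n = 𝟙 _ := by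
  induction n with
  | zero => exact terminal.hom_ext _ _
  | succ n ih => exact (congrArg _ ih).trans ((lift hM).map_id _)

/-- The map `Lⁿ 1 ⟶ ω̄` with components `iterMap`. -/
noncomputable def toOmegaBar (hM : PreAdmissible S.cov M)
    (h0 : ∀ c : C, M (S.zeroInitial.to c)) (n : ℕ) : iter hM n ⟶ omegaBar hM :=
  limit.lift (Functor.ofOpSequence (down hM)) ⟨iter hM n, NatTrans.ofOpSequence
    (fun m => iterMap hM h0 n m)
    (fun m => by
      rw [Functor.ofOpSequence_map_homOfLE_succ]
      exact (Category.id_comp _).trans (iterMap_down hM h0 n m).symm)⟩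

theorem toOmegaBar_π (hM : PreAdmissible S.cov M) (h0 : ∀ c : C, M (S.zeroInitial.to c))
    (n m : ℕ) : toOmegaBar hM h0 n ≫ limit.π (Functor.ofOpSequence (down hM)) (op m) =
      iterMap hM h0 n m :=
  limit.lift_π _ _

theorem up_toOmegaBar (hM : PreAdmissible S.cov M) (h0 : ∀ c : C, M (S.zeroInitial.to c))
    (n : ℕ) : up hM h0 n ≫ toOmegaBar hM h0 (n + 1) = toOmegaBar hM h0 n := by
  apply limit.hom_ext
  rintro ⟨m⟩
  refine (Category.assoc _ _ _).trans ?_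
  refine (congrArg _ (toOmegaBar_π hM h0 (n + 1) m)).trans ?_
  exact (up_iterMap hM h0 n m).trans (toOmegaBar_π hM h0 n m).symm

/-- The comparison map `i : ω ⟶ ω̄`. -/
noncomputable def comparison (hM : PreAdmissible S.cov M)
    (h0 : ∀ c : C, M (S.zeroInitial.to c)) : omega hM h0 ⟶ omegaBar hM :=
  colimit.desc (Functor.ofSequence (up hM h0)) ⟨omegaBar hM, NatTrans.ofSequence
    (fun n => toOmegaBar hM h0 n)
    (fun n => by
      rw [Functor.ofSequence_map_homOfLE_succ]
      exact (up_toOmegaBar hM h0 n).trans (Category.comp_id _).symm)⟩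

/-- `X` is right-orthogonal to `f`: every map `A ⟶ X` factors uniquely through `f`. -/
def RightOrthogonal {D : Type*} [Category D] {A B : D} (f : A ⟶ B) (X : D) : Prop :=
  ∀ g : A ⟶ X, ∃! h : B ⟶ X, f ≫ h = g

/-- `X` is `L`-complete: it is right-orthogonal to `i × 1_A : ω × A ⟶ ω̄ × A` for every sheaf `A`
(equivalently, `Xⁱ : X^ω̄ ⟶ X^ω` is an isomorphism). -/
def IsLComplete (hM : PreAdmissible S.cov M) (h0 : ∀ c : C, M (S.zeroInitial.to c))
    (X : Sheaf S.cov.toGrothendieck (Type u)) : Prop :=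
  ∀ A : Sheaf S.cov.toGrothendieck (Type u),
    RightOrthogonal (prod.map (comparison hM h0) (𝟙 A)) X

instance hasNatCoproducts (J : GrothendieckTopology C) :
    HasColimitsOfShape (Discrete ℕ) (Sheaf J (Type u)) :=
  ⟨fun _ => HasColimit.mk ⟨Sheaf.sheafifyCocone (colimit.cocone _),
    Sheaf.isColimitSheafifyCocone _ (colimit.isColimit _)⟩⟩

/-- The countably infinite coproduct of copies of `1` in the sheaf topos. -/
noncomputable def natSheaf (S : ConcreteSite C) : Sheaf S.cov.toGrothendieck (Type u) :=
  ∐ fun _ : ℕ => ⊤_ (Sheaf S.cov.toGrothendieck (Type u))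

end Chains


section VerticalNaturals

open OmegaCompletePartialOrder

theorem cont_add (n : ℕ) : ωScottContinuous fun x : ℕ∞ => x + n := by
  refine ωScottContinuous.of_monotone_map_ωSup ⟨fun x y h => add_le_add_left h _, fun c => ?_⟩
  exact ENat.iSup_add _

theorem cont_of_add {g : ℕ∞ → ℕ∞} (n : ℕ) (h : ωScottContinuous fun x => g x + n) :
    ωScottContinuous g := by
  have hm : Monotone g := fun x y hxy =>
    (ENat.add_le_add_iff_right (ENat.natCast_ne_top n)).1 (h.monotone hxy)
  refine ωScottContinuous.of_monotone_map_ωSup ⟨hm, fun c => ?_⟩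
  apply WithTop.add_right_cancel (ENat.natCast_ne_top n)
  refine (h.map_ωSup c).trans ?_
  exact (ENat.iSup_add (fun i => g (c i))).symm

theorem exists_threshold {f : ℕ∞ → ℕ∞} (hf : ωScottContinuous f) (n : ℕ)
    (h : ∃ x, (n : ℕ∞) ≤ f x) : ∃ k : ℕ, ∀ x : ℕ∞, (n : ℕ∞) ≤ f x ↔ (k : ℕ∞) ≤ x := by
  have h' : ∃ k : ℕ, (n : ℕ∞) ≤ f k := by
    by_contra! hlt
    obtain ⟨x, hx⟩ := h
    have htop : f ⊤ = ⨆ i : ℕ, f i := by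
      have h1 := hf.map_ωSup ⟨fun i : ℕ => (i : ℕ∞), fun i j hij => Nat.cast_le.2 hij⟩
      have h2 : ωSup (⟨fun i : ℕ => (i : ℕ∞), fun i j hij => Nat.cast_le.2 hij⟩ : Chain ℕ∞) = ⊤ :=
        ENat.iSup_natCast
      rw [h2] at h1
      exact h1
    cases n with
    | zero => simpa using hlt 0
    | succ m =>
      have h3 : f ⊤ ≤ m := by
        rw [htop]
        exact iSup_le fun i => ENat.lt_natCast_add_one_iff.1 (by exact_mod_cast hlt i)
      have h4 := hx.trans ((hf.monotone le_top).trans h3)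
      have : m + 1 ≤ m := by exact_mod_cast h4
      omega
  classical
  refine ⟨Nat.find h', fun x => ⟨fun hx => ?_, fun hx => (Nat.find_spec h').trans (hf.monotone hx)⟩⟩
  induction x using ENat.recTopCoe with
  | top => exact le_top
  | coe x => exact_mod_cast Nat.find_min' h' hx

end VerticalNaturals

section Combined

variable {C : Type u} [SmallCategory C]

/-- The objects of `C + V₀`, where `V₀` is the full subcategory of ωCPO on `V = ω + 1 = ℕ ∪ {∞}`, the
terminal object and the initial object. As the terminal and initial objects of `V₀` are identified
with those of `C`, the only new object is `V`, called `vert`. -/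
inductive Comb (_S : ConcreteSite C) : Type u
  | of (c : C) : Comb _S
  | vert : Comb _S

namespace Comb

variable {S : ConcreteSite C}

/-- The set of points of an object of `C + V₀`. -/
def Pt : Comb S → Type u
  | of c => S.star ⟶ c
  | vert => ULift.{u} ℕ∞

/-- The functions on points that are morphisms of `C + V₀`: those induced by morphisms of `C`, the
ω-continuous endomaps of `V`, and the constant maps between `V` and objects of `C`. -/
def IsMor : ∀ X Y : Comb S, (Pt X → Pt Y) → Prop
  | of c, of d, f => ∃ h : c ⟶ d, ∀ p : S.star ⟶ c, f p = p ≫ h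
  | vert, vert, f => OmegaCompletePartialOrder.ωScottContinuous fun n : ℕ∞ => (f ⟨n⟩).down
  | of _, vert, f => ∀ p q, f p = f q
  | vert, of _, f => ∀ p q, f p = f q

theorem isMor_const (X : Comb S) {Y : Comb S} (y : Pt Y) : IsMor X Y fun _ => y := by
  cases X <;> cases Y
  · refine ⟨S.starTerminal.from _ ≫ y, fun p => ?_⟩
    refine Eq.trans ?_ (Category.assoc p (S.starTerminal.from _) y)
    rw [S.starTerminal.hom_ext (p ≫ S.starTerminal.from _) (𝟙 _)]
    exact (Category.id_comp _).symm
  · exact fun _ _ => rfl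
  · exact fun _ _ => rfl
  · exact OmegaCompletePartialOrder.ωScottContinuous.const

theorem isMor_id (X : Comb S) : IsMor X X id := by
  cases X
  · exact ⟨𝟙 _, fun p => (Category.comp_id p).symm⟩
  · exact OmegaCompletePartialOrder.ωScottContinuous.id

theorem isMor_comp {X Y Z : Comb S} {f : Pt X → Pt Y} {g : Pt Y → Pt Z}
    (hf : IsMor X Y f) (hg : IsMor Y Z g) : IsMor X Z (g ∘ f) := by
  rcases X with c | _ <;> rcases Y with d | _ <;> rcases Z with e | _
  · obtain ⟨h, hh⟩ := hf
    obtain ⟨k, hk⟩ := hg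
    exact ⟨h ≫ k, fun p => by
      change g (f p) = _
      rw [hh, hk]
      exact Category.assoc _ _ _⟩
  · exact fun p q => hg _ _
  · have : g ∘ f = fun _ => g ⟨0⟩ := funext fun p => hg _ _
    rw [this]
    exact isMor_const _ _
  · exact fun p q => congrArg g (hf p q)
  · exact fun p q => congrArg g (hf p q)
  · have : g ∘ f = fun _ => g (f ⟨0⟩) := funext fun p => congrArg g (hf p ⟨0⟩)
    rw [this]
    exact isMor_const _ _
  · exact fun p q => hg _ _
  · exact OmegaCompletePartialOrder.ωScottContinuous.comp
      (f := fun n : ℕ∞ => (f ⟨n⟩).down) (g := fun n : ℕ∞ => (g ⟨n⟩).down) hg hf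

structure Hom (X Y : Comb S) : Type u where
  toFun : Pt X → Pt Y
  isMor : IsMor X Y toFun

instance : SmallCategory (Comb S) where
  Hom := Hom
  id X := ⟨id, isMor_id X⟩
  comp f g := ⟨g.toFun ∘ f.toFun, isMor_comp f.isMor g.isMor⟩

theorem hom_ext {X Y : Comb S} {f g : X ⟶ Y} (h : ∀ x, f.toFun x = g.toFun x) : f = g := by
  obtain ⟨f, hf⟩ := f
  obtain ⟨g, hg⟩ := g
  obtain rfl : f = g := funext h
  rfl

@[simp]
theorem comp_toFun {X Y Z : Comb S} (f : X ⟶ Y) (g : Y ⟶ Z) (x : Pt X) :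
    (f ≫ g).toFun x = g.toFun (f.toFun x) := rfl

@[simp]
theorem id_toFun (X : Comb S) (x : Pt X) : Hom.toFun (𝟙 X) x = x := rfl

/-- The constant map with value `y`. -/
def const (X : Comb S) {Y : Comb S} (y : Pt Y) : X ⟶ Y := ⟨fun _ => y, isMor_const X y⟩

/-- The inclusion of `C` in `C + V₀` on morphisms. -/
def incl {c d : C} (h : c ⟶ d) : (of c : Comb S) ⟶ of d := ⟨fun p => p ≫ h, h, fun _ => rfl⟩

theorem incl_id (c : C) : incl (S := S) (𝟙 c) = 𝟙 (of c) := hom_ext fun p => Category.comp_id p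

theorem incl_comp {b c d : C} (f : b ⟶ c) (g : c ⟶ d) :
    incl (S := S) (f ≫ g) = incl f ≫ incl g :=
  hom_ext fun p => (Category.assoc p f g).symm

theorem incl_injective {c d : C} {f g : c ⟶ d} (h : incl (S := S) f = incl g) : f = g :=
  S.hom_ext _ _ fun p => congrFun (congrArg Hom.toFun h) p

theorem exists_incl {c d : C} (f : (of c : Comb S) ⟶ of d) : ∃ h : c ⟶ d, f = incl h := by
  obtain ⟨h, hh⟩ := f.isMor
  exact ⟨h, hom_ext hh⟩

def starTerminal : IsTerminal (of S.star : Comb S) :=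
  IsTerminal.ofUniqueHom (fun X => const X (𝟙 S.star : S.star ⟶ S.star))
    fun _ _ => hom_ext fun _ => S.starTerminal.hom_ext _ _

theorem isEmpty_zero (x : Pt (of S.zero : Comb S)) : False := S.no_points_zero x

theorem isMor_zero (X : Comb S) (f : Pt (of S.zero : Comb S) → Pt X) : IsMor (of S.zero) X f := by
  cases X
  · exact ⟨S.zeroInitial.to _, fun p => (isEmpty_zero p).elim⟩
  · exact fun p => (isEmpty_zero p).elim

def zeroInitial : IsInitial (of S.zero : Comb S) :=
  IsInitial.ofUniqueHom (fun X => ⟨fun x => (isEmpty_zero x).elim, isMor_zero X _⟩)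
    fun _ _ => hom_ext fun x => (isEmpty_zero x).elim

/-- The image in `C + V₀` of a family of maps in `C`. -/
inductive InclCover {c : C} (R : Presieve c) : Presieve (of c : Comb S)
  | mk {d : C} {f : d ⟶ c} (hf : R f) : InclCover R (incl f)

variable (S) in
/-- The covering families `J ∪ J_V`: those of `C`, and the identity of `V`. Those of `J_V` on the
terminal and the initial object are in `J` by its axioms (M) and (0). -/
def covering : ∀ X : Comb S, Set (Presieve X)
  | of c => {R | ∃ R₀ ∈ S.cov c, R = InclCover R₀}
  | vert => {Presieve.singleton (𝟙 vert)}

theorem singleton_mem (X : Comb S) : Presieve.singleton (𝟙 X) ∈ covering S X := by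
  cases X with
  | of c =>
    refine ⟨_, S.cov_id c, ?_⟩
    funext X f
    apply propext
    constructor
    · rintro ⟨⟩
      rw [← incl_id]
      exact ⟨⟨⟩⟩
    · rintro ⟨⟨⟩⟩
      rw [incl_id]
      exact ⟨⟩
  | vert => rfl

variable (S) in
/-- The coverage `J ∪ J_V`. -/
def coverage : Coverage (Comb S) where
  coverings := covering S
  pullback := by
    rintro (c | _) (d | _) f R hR
    · obtain ⟨R, hR, rfl⟩ := hR
      obtain ⟨h, rfl⟩ := exists_incl f
      obtain ⟨T, hT, hTR⟩ := S.cov.pullback h R hR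
      refine ⟨_, ⟨T, hT, rfl⟩, ?_⟩
      rintro _ _ ⟨hg⟩
      obtain ⟨b, i, e, he, hi⟩ := hTR hg
      exact ⟨of b, incl i, incl e, ⟨he⟩, by rw [← incl_comp, hi, incl_comp]⟩
    · obtain ⟨R, hR, rfl⟩ := hR
      refine ⟨_, singleton_mem _, ?_⟩
      rintro _ _ ⟨⟩
      obtain ⟨b, e, q, he, hq⟩ := S.cov_points c R hR (f.toFun ⟨0⟩)
      refine ⟨of b, const vert (Y := of b) q, incl e, ⟨he⟩, hom_ext fun x => ?_⟩
      exact hq.trans (f.isMor _ _)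
    · obtain rfl : R = _ := hR
      refine ⟨_, singleton_mem _, ?_⟩
      rintro _ _ ⟨⟩
      exact ⟨_, f, 𝟙 _, ⟨⟩, by simp⟩
    · obtain rfl : R = _ := hR
      refine ⟨_, singleton_mem _, ?_⟩
      rintro _ _ ⟨⟩
      exact ⟨_, f, 𝟙 _, ⟨⟩, by simp⟩

variable (S) in
/-- The concrete site `(C + V₀, J ∪ J_V)`. -/
def site : ConcreteSite (Comb S) where
  star := of S.star
  starTerminal := starTerminal
  zero := of S.zero
  zeroInitial := zeroInitial
  faithful := ⟨by
    intro X Y f g h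
    refine hom_ext fun x => ?_
    have := ConcreteCategory.congr_hom h (const (of S.star) x)
    exact congrFun (congrArg Hom.toFun this) (𝟙 S.star : S.star ⟶ S.star)⟩
  cov := coverage S
  cov_points := by
    rintro (c | _) R hR p
    · obtain ⟨R, hR, rfl⟩ := hR
      obtain ⟨p, rfl⟩ := exists_incl p
      obtain ⟨d, f, q, hf, rfl⟩ := S.cov_points c R hR p
      exact ⟨of d, incl f, incl q, ⟨hf⟩, (incl_comp _ _).symm⟩
    · obtain rfl : R = _ := hR
      exact ⟨vert, 𝟙 _, p, ⟨⟩, Category.comp_id _⟩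
  cov_zero := by
    refine ⟨_, S.cov_zero, ?_⟩
    funext d
    ext f
    constructor
    · rintro ⟨⟩
    · rintro ⟨⟨⟩⟩
  cov_id := singleton_mem
  cov_bind := by
    rintro (c | _) R T hR hT
    · obtain ⟨R, hR, rfl⟩ := hR
      have hT' : ∀ ⦃d : C⦄ ⦃f : d ⟶ c⦄ (hf : R f), ∃ T' ∈ S.cov d,
          T (InclCover.mk hf) = InclCover T' := fun d f hf => hT (InclCover.mk hf)
      choose T' hT' hTT' using hT'
      refine ⟨_, S.cov_bind c R (fun d f hf => T' hf) hR fun d f hf => hT' hf, ?_⟩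
      funext X f
      apply propext
      constructor
      · rintro ⟨_, g, _, ⟨hf⟩, hg, rfl⟩
        rw [hTT' hf] at hg
        obtain ⟨hg⟩ := hg
        rw [← incl_comp]
        exact ⟨⟨_, _, _, hf, hg, rfl⟩⟩
      · rintro ⟨⟨d, g, f, hf, hg, rfl⟩⟩
        refine ⟨of d, incl g, incl f, ⟨hf⟩, ?_, ?_⟩
        · rw [hTT' hf]
          exact ⟨hg⟩
        · rw [incl_comp]
    · obtain rfl : R = _ := hR
      have h : T (Presieve.singleton.mk (f := 𝟙 (vert : Comb S))) = Presieve.singleton (𝟙 _) :=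
        hT (Presieve.singleton.mk (f := 𝟙 (vert : Comb S)))
      change _ = _
      funext X f
      apply propext
      constructor
      · rintro ⟨_, g, _, ⟨⟩, hg, rfl⟩
        rw [h] at hg
        rw [Category.comp_id]
        exact hg
      · rintro ⟨⟩
        refine ⟨_, 𝟙 _, 𝟙 _, ⟨⟩, ?_, by simp⟩
        rw [h]
        exact ⟨⟩

/-- The map `x ↦ x + n` of `V`. -/
def shift (n : ℕ) : (vert : Comb S) ⟶ vert := ⟨fun x => ⟨x.down + n⟩, cont_add n⟩

/-- The maps in `M ∪ M_V`: those of `M`, the maps `x ↦ x + n` of `V`, and the map from the initial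
object to `V` (for any initial object, so that the class is closed under isomorphism). -/
def IsAdm (M : MorphismProperty C) : ∀ X Y : Comb S, (X ⟶ Y) → Prop
  | of b, of c, f => ∃ m : b ⟶ c, M m ∧ f = incl m
  | vert, vert, f => ∃ n : ℕ, f = shift n
  | of b, vert, _ => Nonempty (IsInitial b)
  | vert, of _, _ => False

variable (S) in
/-- The class of monos `M ∪ M_V` of `C + V₀`. -/
def adm (M : MorphismProperty C) : MorphismProperty (Comb S) := fun X Y f => IsAdm M X Y f

theorem isEmpty_of_isInitial {b : C} (h : IsInitial b) (p : S.star ⟶ b) : False :=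
  S.no_points_zero (p ≫ h.to S.zero)

theorem isInitial_of_isEmpty {M : MorphismProperty C} (hM : Admissible S M) {b : C}
    (h : (S.star ⟶ b) → False) : Nonempty (IsInitial b) := by
  obtain ⟨f, hf⟩ := hM.reflects (𝟙 b) (S.zeroInitial.to b) (hM.iso _ inferInstance)
    (hM.zero_mem b) (fun _ ⟨p, _⟩ => (h p).elim)
  exact ⟨S.zeroInitial.ofIso ⟨S.zeroInitial.to b, f, S.zeroInitial.hom_ext _ _, hf⟩⟩

theorem injective_of_adm {M : MorphismProperty C} (hM : Admissible S M) {X Y : Comb S}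
    {m : X ⟶ Y} (hm : adm S M m) : Function.Injective m.toFun := by
  rcases X with b | _ <;> rcases Y with c | _
  · obtain ⟨m, hm, rfl⟩ := hm
    intro p q hpq
    have := hM.mono m hm
    exact (cancel_mono m).1 hpq
  · obtain ⟨hb⟩ := hm
    intro p
    exact (isEmpty_of_isInitial hb p).elim
  · exact hm.elim
  · obtain ⟨n, rfl⟩ := hm
    rintro ⟨x⟩ ⟨y⟩ hxy
    have h : x + n = y + n := congrArg ULift.down hxy
    exact congrArg ULift.up (WithTop.add_right_cancel (ENat.natCast_ne_top n) h)

theorem mono_of_injective {X Y : Comb S} {m : X ⟶ Y} (h : Function.Injective m.toFun) :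
    Mono m :=
  ⟨fun _ _ hfg => hom_ext fun x => h (congrFun (congrArg Hom.toFun hfg) x)⟩

theorem isEmpty_of_to_zero {X : Comb S} (k : X ⟶ of S.zero) (x : Pt X) : False :=
  isEmpty_zero (k.toFun x)

theorem adm_zero {M : MorphismProperty C} (hM : Admissible S M) (X : Comb S) :
    adm S M ((site S).zeroInitial.to X) := by
  cases X with
  | of c => exact ⟨S.zeroInitial.to c, hM.zero_mem c, (site S).zeroInitial.hom_ext _ _⟩
  | vert => exact ⟨S.zeroInitial⟩

theorem adm_id {M : MorphismProperty C} (hM : Admissible S M) (X : Comb S) :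
    adm S M (𝟙 X) := by
  cases X with
  | of c => exact ⟨𝟙 c, hM.iso _ inferInstance, (incl_id c).symm⟩
  | vert => exact ⟨0, hom_ext fun x => congrArg ULift.up (by simp)⟩

theorem exists_to_zero {M : MorphismProperty C} (hM : Admissible S M) {X : Comb S}
    (h : Pt X → False) : Nonempty (X ⟶ of S.zero) := by
  cases X with
  | of c =>
    obtain ⟨hc⟩ := isInitial_of_isEmpty hM h
    exact ⟨incl (hc.to _)⟩
  | vert => exact (h ⟨0⟩).elim

theorem pullback_of_factor {M : MorphismProperty C} (hM : Admissible S M) {X Y Z : Comb S}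
    (m : X ⟶ Y) (hm : adm S M m) (f : Z ⟶ Y) (g : Z ⟶ X) (h : ∀ z, m.toFun (g.toFun z) = f.toFun z) :
    ∃ (W : Comb S) (g : W ⟶ X) (n : W ⟶ Z), adm S M n ∧ IsPullback g n m f := by
  have hmono := mono_of_injective (injective_of_adm hM hm)
  refine ⟨Z, g, 𝟙 Z, adm_id hM Z, ⟨⟨hom_ext h⟩, ⟨PullbackCone.IsLimit.mk _ (fun s => s.snd)
    (fun s => ?_) (fun s => Category.comp_id _) (fun s k _ hk => by simpa using hk)⟩⟩⟩
  rw [← cancel_mono m, s.condition, Category.assoc]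
  exact congrArg _ (hom_ext h)

theorem pullback_of_disjoint {M : MorphismProperty C} (hM : Admissible S M) {X Y Z : Comb S}
    (m : X ⟶ Y) (f : Z ⟶ Y) (h : ∀ x z, m.toFun x ≠ f.toFun z) :
    ∃ (W : Comb S) (g : W ⟶ X) (n : W ⟶ Z), adm S M n ∧ IsPullback g n m f := by
  have hex : ∀ s : PullbackCone m f, Nonempty (s.pt ⟶ of S.zero) := fun s =>
    exists_to_zero hM fun x => h _ _ (congrFun (congrArg Hom.toFun s.condition) x)
  refine ⟨of S.zero, (site S).zeroInitial.to X, (site S).zeroInitial.to Z, adm_zero hM Z,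
    ⟨⟨(site S).zeroInitial.hom_ext _ _⟩, ⟨PullbackCone.IsLimit.mk _ (fun s => (hex s).some)
    (fun s => ?_) (fun s => ?_) (fun s k _ _ => ?_)⟩⟩⟩
  all_goals exact hom_ext fun x => (isEmpty_of_to_zero (hex s).some x).elim

theorem adm_comp {M : MorphismProperty C} (hM : Admissible S M) {X Y Z : Comb S}
    (m : X ⟶ Y) (n : Y ⟶ Z) (hm : adm S M m) (hn : adm S M n) : adm S M (m ≫ n) := by
  rcases X with b | _ <;> rcases Y with c | _ <;> rcases Z with d | _
  · obtain ⟨m, hm, rfl⟩ := hm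
    obtain ⟨n, hn, rfl⟩ := hn
    exact ⟨m ≫ n, hM.comp _ _ hm hn, (incl_comp _ _).symm⟩
  · obtain ⟨m, hm, rfl⟩ := hm
    obtain ⟨hc⟩ := hn
    exact isInitial_of_isEmpty hM fun p => isEmpty_of_isInitial hc (p ≫ m)
  · exact hn.elim
  · exact hm
  · exact hm.elim
  · exact hm.elim
  · exact hn.elim
  · obtain ⟨a, rfl⟩ := hm
    obtain ⟨a', rfl⟩ := hn
    refine ⟨a + a', hom_ext fun x => congrArg ULift.up ?_⟩
    change x.down + a + a' = x.down + (a + a' : ℕ)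
    push_cast
    exact add_assoc _ _ _

theorem adm_iso {M : MorphismProperty C} (hM : Admissible S M) {X Y : Comb S}
    (m : X ⟶ Y) (hm : IsIso m) : adm S M m := by
  have h1 : ∀ x, (inv m).toFun (m.toFun x) = x := fun x =>
    congrFun (congrArg Hom.toFun (IsIso.hom_inv_id m)) x
  have h2 : ∀ x, m.toFun ((inv m).toFun x) = x := fun x =>
    congrFun (congrArg Hom.toFun (IsIso.inv_hom_id m)) x
  have h01 : (⟨0⟩ : ULift.{u} ℕ∞) ≠ ⟨1⟩ := fun h => zero_ne_one (congrArg ULift.down h)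
  rcases X with b | _ <;> rcases Y with c | _
  · obtain ⟨k, hk⟩ := exists_incl m
    obtain ⟨l, hl⟩ := exists_incl (inv m)
    refine ⟨k, hM.iso _ ⟨l, ?_, ?_⟩, hk⟩
    · apply incl_injective (S := S)
      rw [incl_comp, ← hk, ← hl, IsIso.hom_inv_id, incl_id]
    · apply incl_injective (S := S)
      rw [incl_comp, ← hk, ← hl, IsIso.inv_hom_id, incl_id]
  · exact (h01 ((h2 ⟨0⟩).symm.trans ((m.isMor _ _).trans (h2 ⟨1⟩)))).elim
  · exact (h01 ((h1 ⟨0⟩).symm.trans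
      ((congrArg (inv m).toFun (m.isMor ⟨0⟩ ⟨1⟩)).trans (h1 ⟨1⟩)))).elim
  · have hf := OmegaCompletePartialOrder.ωScottContinuous.monotone m.isMor
    have hg := OmegaCompletePartialOrder.ωScottContinuous.monotone (inv m).isMor
    let e : ℕ∞ ≃o ℕ∞ :=
      { toFun := fun x => (m.toFun ⟨x⟩).down
        invFun := fun x => ((inv m).toFun ⟨x⟩).down
        left_inv := fun x => congrArg ULift.down (h1 ⟨x⟩)
        right_inv := fun x => congrArg ULift.down (h2 ⟨x⟩)
        map_rel_iff' := by
          intro x y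
          refine ⟨fun h => ?_, fun h => hf h⟩
          have := hg h
          have e1 : ((inv m).toFun (m.toFun ⟨x⟩)).down = x := congrArg ULift.down (h1 ⟨x⟩)
          have e2 : ((inv m).toFun (m.toFun ⟨y⟩)).down = y := congrArg ULift.down (h1 ⟨y⟩)
          exact e1 ▸ e2 ▸ this }
    have he : e = OrderIso.refl ℕ∞ := Subsingleton.elim _ _
    refine ⟨0, hom_ext fun x => ULift.ext _ _ ?_⟩
    have : e x.down = x.down := by rw [he]; rfl
    refine Eq.trans this ?_
    change x.down = x.down + (0 : ℕ)
    simp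

theorem adm_pullback {M : MorphismProperty C} (hM : Admissible S M) {X Y Z : Comb S}
    (m : X ⟶ Y) (f : Z ⟶ Y) (hm : adm S M m) :
    ∃ (W : Comb S) (g : W ⟶ X) (n : W ⟶ Z), adm S M n ∧ IsPullback g n m f := by
  by_cases hd : ∀ x z, m.toFun x ≠ f.toFun z
  · exact pullback_of_disjoint hM m f hd
  push Not at hd
  obtain ⟨x, z, hxz⟩ := hd
  have hconst : (∀ a b, f.toFun a = f.toFun b) →
      ∃ (W : Comb S) (g : W ⟶ X) (n : W ⟶ Z), adm S M n ∧ IsPullback g n m f := fun h =>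
    pullback_of_factor hM m hm f (const Z x) fun w => hxz.trans (h _ _)
  rcases X with b | _ <;> rcases Y with c | _ <;> rcases Z with d | _
  · obtain ⟨m, hm, rfl⟩ := hm
    obtain ⟨f, rfl⟩ := exists_incl f
    obtain ⟨e, g, n, hn, h⟩ := hM.pullback m f hm
    have hi : Function.Injective (incl (S := S) n).toFun :=
      injective_of_adm hM (M := M) ⟨n, hn, rfl⟩
    have hmono := mono_of_injective hi
    have hmono' := mono_of_injective (injective_of_adm hM (M := M) (m := incl (S := S) m)
      ⟨m, hm, rfl⟩)
    have hw : incl (S := S) g ≫ incl m = incl n ≫ incl f := by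
      rw [← incl_comp, h.w, incl_comp]
    have hl : ∀ s : PullbackCone (incl (S := S) m) (incl f),
        ∃ l : s.pt ⟶ of e, l ≫ incl n = s.snd := by
      intro s
      obtain ⟨W, fst, snd, hs⟩ : ∃ (W : Comb S) (fst : W ⟶ of b) (snd : W ⟶ of d),
          fst ≫ incl m = snd ≫ incl f := ⟨_, s.fst, s.snd, s.condition⟩
      have hgen : ∀ (W : Comb S) (fst : W ⟶ of b) (snd : W ⟶ of d),
          fst ≫ incl m = snd ≫ incl f → ∃ l : W ⟶ of e, l ≫ incl n = snd := by
        intro W fst snd hs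
        cases W with
        | of a =>
          obtain ⟨fst, rfl⟩ := exists_incl fst
          obtain ⟨snd, rfl⟩ := exists_incl snd
          rw [← incl_comp, ← incl_comp] at hs
          exact ⟨incl (h.lift fst snd (incl_injective hs)), by rw [← incl_comp, h.lift_snd]⟩
        | vert =>
          have h0 := congrFun (congrArg Hom.toFun hs) ⟨0⟩
          refine ⟨const vert (Y := of e) (h.lift (fst.toFun ⟨0⟩) (snd.toFun ⟨0⟩) h0),
            hom_ext fun x => ?_⟩
          exact (h.lift_snd _ _ _).trans (snd.isMor _ _)
      exact hgen _ s.fst s.snd s.condition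
    refine ⟨of e, incl g, incl n, ⟨n, hn, rfl⟩, ⟨⟨hw⟩, ⟨PullbackCone.IsLimit.mk _
      (fun s => (hl s).choose) (fun s => ?_) (fun s => (hl s).choose_spec) (fun s k _ hk => ?_)⟩⟩⟩
    · rw [← cancel_mono (incl m), Category.assoc, hw, ← Category.assoc, (hl s).choose_spec,
        s.condition]
    · rw [← cancel_mono (incl n), hk, (hl s).choose_spec]
  · exact hconst f.isMor
  · obtain ⟨hb⟩ := hm
    exact (isEmpty_of_isInitial hb x).elim
  · obtain ⟨hb⟩ := hm
    exact (isEmpty_of_isInitial hb x).elim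
  · exact hm.elim
  · exact hm.elim
  · exact hconst f.isMor
  · obtain ⟨n, rfl⟩ := hm
    have hf : OmegaCompletePartialOrder.ωScottContinuous fun y : ℕ∞ => (f.toFun ⟨y⟩).down :=
      f.isMor
    obtain ⟨k, hk⟩ := exists_threshold hf n ⟨z.down, by
      have : x.down + n = (f.toFun z).down := congrArg ULift.down hxz
      exact this ▸ le_add_self⟩
    have hsub : ∀ y : ℕ∞, (f.toFun ⟨y + k⟩).down - n + n = (f.toFun ⟨y + k⟩).down := fun y =>
      tsub_add_cancel_of_le ((hk _).2 le_add_self)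
    let g : (vert : Comb S) ⟶ vert := ⟨fun y => ⟨(f.toFun ⟨y.down + k⟩).down - n⟩,
      cont_of_add n (by
        have := hf.comp (cont_add k)
        convert this using 1
        funext y
        exact hsub y)⟩
    have hmono := mono_of_injective (injective_of_adm hM (M := M) (m := shift (S := S) k)
      ⟨k, rfl⟩)
    have hmono' := mono_of_injective (injective_of_adm hM (M := M) (m := shift (S := S) n)
      ⟨n, rfl⟩)
    have hw : g ≫ shift n = shift k ≫ f := hom_ext fun y => ULift.ext _ _ (hsub y.down)
    have hl : ∀ s : PullbackCone (shift (S := S) n) f, ∃ l : s.pt ⟶ vert, l ≫ shift k = s.snd := by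
      have hgen : ∀ (W : Comb S) (fst : W ⟶ vert) (snd : W ⟶ vert),
          fst ≫ shift n = snd ≫ f → ∃ l : W ⟶ vert, l ≫ shift k = snd := by
        intro W fst snd hs
        have hle : ∀ w : Pt W, (k : ℕ∞) ≤ (snd.toFun w).down := fun w => by
          rw [← hk]
          have : (fst.toFun w).down + n = (f.toFun (snd.toFun w)).down :=
            congrArg ULift.down (congrFun (congrArg Hom.toFun hs) w)
          exact this ▸ le_add_self
        have hc : ∀ w, (snd.toFun w).down - k + k = (snd.toFun w).down := fun w =>
          tsub_add_cancel_of_le (hle w)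
        refine ⟨⟨fun w => ⟨(snd.toFun w).down - k⟩, ?_⟩, hom_ext fun w => ULift.ext _ _ (hc w)⟩
        cases W with
        | of a =>
          intro p q
          have h : snd.toFun p = snd.toFun q := snd.isMor p q
          change ULift.up ((snd.toFun p).down - k) = ULift.up ((snd.toFun q).down - k)
          rw [h]
        | vert =>
          refine cont_of_add k ?_
          have h : OmegaCompletePartialOrder.ωScottContinuous
              fun y : ℕ∞ => (snd.toFun ⟨y⟩).down := snd.isMor
          convert h using 1
          funext y
          exact hc ⟨y⟩
      exact fun s => hgen _ s.fst s.snd s.condition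
    refine ⟨vert, g, shift k, ⟨k, rfl⟩, ⟨⟨hw⟩, ⟨PullbackCone.IsLimit.mk _
      (fun s => (hl s).choose) (fun s => ?_) (fun s => (hl s).choose_spec) (fun s k' _ hk' => ?_)⟩⟩⟩
    · rw [← cancel_mono (shift n), Category.assoc, hw, ← Category.assoc, (hl s).choose_spec,
        s.condition]
    · rw [← cancel_mono (shift k), hk', (hl s).choose_spec]

theorem adm_stable {M : MorphismProperty C} (hM : Admissible S M) : StableMonos (adm S M) where
  mono _ hm := mono_of_injective (injective_of_adm hM hm)
  iso m hm := adm_iso hM m hm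
  comp m n hm hn := adm_comp hM m n hm hn
  pullback m f hm := adm_pullback hM m f hm

/-- The sieve of morphisms of `C` that belong to `U`. -/
def res {c : C} (U : Sieve (of c : Comb S)) : Sieve c where
  arrows d f := U (incl f)
  downward_closed := by
    intro d e f hf g
    rw [incl_comp]
    exact U.downward_closed hf _

theorem isSub_iff {M : MorphismProperty C} {c : C} {U : Sieve (of c : Comb S)} :
    IsSub (adm S M) U ↔ ∃ (b : C) (m : b ⟶ c), M m ∧ U = sieveOf (incl m) := by
  constructor
  · rintro ⟨b | _, m, hm, rfl⟩
    · obtain ⟨m, hm, rfl⟩ := hm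
      exact ⟨b, m, hm, rfl⟩
    · exact hm.elim
  · rintro ⟨b, m, hm, rfl⟩
    exact ⟨of b, incl m, ⟨m, hm, rfl⟩, rfl⟩

theorem res_sieveOf {b c : C} (m : b ⟶ c) : res (S := S) (sieveOf (incl m)) = sieveOf m := by
  ext d f
  constructor
  · rintro ⟨g, hg⟩
    obtain ⟨g, rfl⟩ := exists_incl g
    rw [← incl_comp] at hg
    exact ⟨g, incl_injective hg⟩
  · rintro ⟨g, rfl⟩
    exact ⟨incl g, (incl_comp _ _).symm⟩

theorem sieveOf_incl_le {b b' c : C} {m : b ⟶ c} {m' : b' ⟶ c} (h : sieveOf m ≤ sieveOf m') :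
    sieveOf (incl (S := S) m) ≤ sieveOf (incl m') := by
  obtain ⟨f, rfl⟩ := (sieveOf_le_iff _ _).1 h
  exact (sieveOf_le_iff _ _).2 ⟨incl f, (incl_comp _ _).symm⟩

theorem res_injective {M : MorphismProperty C} {c : C} {U U' : Sieve (of c : Comb S)}
    (hU : IsSub (adm S M) U) (hU' : IsSub (adm S M) U') (h : res U = res U') : U = U' := by
  obtain ⟨b, m, -, rfl⟩ := isSub_iff.1 hU
  obtain ⟨b', m', -, rfl⟩ := isSub_iff.1 hU'
  rw [res_sieveOf, res_sieveOf] at h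
  exact le_antisymm (sieveOf_incl_le h.le) (sieveOf_incl_le h.ge)

theorem res_isSub {M : MorphismProperty C} {c : C} {U : Sieve (of c : Comb S)}
    (hU : IsSub (adm S M) U) : IsSub M (res U) := by
  obtain ⟨b, m, hm, rfl⟩ := isSub_iff.1 hU
  exact ⟨b, m, hm, res_sieveOf m⟩

theorem res_pullback {c d : C} (U : Sieve (of c : Comb S)) (f : d ⟶ c) :
    res (U.pullback (incl f)) = (res U).pullback f := by
  ext e g
  change U (incl g ≫ incl f) ↔ U (incl (g ≫ f))
  rw [incl_comp]

theorem adm_preAdmissible {M : MorphismProperty C} (hM : Admissible S M) :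
    PreAdmissible (site S).cov (adm S M) where
  toStableMonos := adm_stable hM
  sheaf := by
    rintro (c | _) R hR
    · obtain ⟨R, hR, rfl⟩ := hR
      intro x hx
      have hS := hM.sheaf c R hR
      have hy : Presieve.FamilyOfElements.Compatible
          (P := Delta M hM.toStableMonos) (R := R)
          (fun d f hf => ⟨res (x (incl f) ⟨hf⟩).1, res_isSub (x (incl f) ⟨hf⟩).2⟩) := by
        intro d d' e g g' f f' hf hf' h
        have h1 := hx (incl g) (incl g') (InclCover.mk hf) (InclCover.mk hf')
          (by rw [← incl_comp, h, incl_comp])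
        have h2 : (x (incl f) ⟨hf⟩).1.pullback (incl g) = (x (incl f') ⟨hf'⟩).1.pullback (incl g') :=
          congrArg Subtype.val h1
        refine Subtype.ext ?_
        exact (res_pullback _ _).symm.trans ((congrArg res h2).trans (res_pullback _ _))
      obtain ⟨U, hU, hUu⟩ := hS _ hy
      have hU' : ∀ ⦃d : C⦄ (f : d ⟶ c) (hf : R f), U.1.pullback f = res (x (incl f) ⟨hf⟩).1 :=
        fun d f hf => congrArg Subtype.val (hU f hf)
      obtain ⟨V, hV, hVU⟩ : ∃ V : Sieve (of c : Comb S), IsSub (adm S M) V ∧ res V = U.1 := by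
        obtain ⟨b, m, hm, h⟩ := U.2
        exact ⟨sieveOf (incl m), isSub_iff.2 ⟨b, m, hm, rfl⟩, (res_sieveOf m).trans h.symm⟩
      refine ⟨⟨V, hV⟩, ?_, ?_⟩
      · rintro _ _ ⟨hf⟩
        refine Subtype.ext (res_injective (hV.pullback (adm_stable hM) _) (Subtype.property _) ?_)
        refine (res_pullback V _).trans ?_
        rw [hVU]
        exact hU' _ hf
      · rintro ⟨W, hW⟩ hWx
        refine Subtype.ext (res_injective hW hV ?_)
        rw [hVU]
        refine congrArg Subtype.val (hUu ⟨res W, res_isSub hW⟩ fun d f hf => Subtype.ext ?_)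
        refine (res_pullback W f).symm.trans (congrArg res ?_)
        exact congrArg Subtype.val (hWx (incl f) ⟨hf⟩)
    · obtain rfl : R = _ := hR
      exact Presieve.isSheafFor_singleton_iso _

end Comb

end Combined

end SDT

/-! Since `Δ ≅ L1` (`deltaIso`), both claims concern `L X` with `X = 1` or `X = ∐ 1`. Each of these
`X` is separated by points, and its sections over `V` are constant.

The object `V` is there to supply paths. Every point `z` of `ω̄ × A` is the value at `∞` of a
section over `V` whose value at `n` is the truncation `tₙ z`. Here `tₙ` sends `z` through `Lⁿ1` and
back, so it factors as `τₙ : ω̄ × A → ω × A` followed by `i × 1` (`exists_prod_vert`). A section of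
`L X` over `V` is `⊥` below some natural number `k` and constant from `k` on, including at `∞`
(`flatOnVert_liftPresheaf`): its domain is empty or of the form `x ≥ k`, and `X` is constant on `V`.

Uniqueness: an extension `h` of `g` takes along the path of `z` the values `h (tₙ z) = g (τₙ z)`. By
flatness these equal `h z` for large `n`, and sections of `L X` are determined at points.

Existence: applying `g ∘ τₙ₊₁` to the path of `z` and using flatness shows that `g (τₙ z)` stays put
once it differs from `⊥`. So the sections `g ∘ τₙ` form a chain that increases at each point. The
domains of such a chain have a union by axiom (iv), and the values glue by axiom (v), which gives a
section that agrees at each point with all late members of the chain (`hasFlatLimits_liftPresheaf`).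
These limits define `h`. It extends `g`, because each point of `ω` comes from a finite stage and is
fixed by late truncations. The argument is assembled in `isLComplete`. -/

namespace SDT

/-! ### Sections of limits and colimits of sheaves -/

section SheafSections

variable {C : Type u} [SmallCategory C] {J : GrothendieckTopology C}

/-- Forgetting to presheaves and evaluating both preserve limits. Hence products, the terminal
object and `ω̄` can be handled section by section. -/
instance preservesLimitsOfShape_sheafSections {K : Type} [SmallCategory K] (c : Cᵒᵖ) :
    PreservesLimitsOfShape K ((sheafSections J (Type u)).obj c) :=
  inferInstanceAs (PreservesLimitsOfShape K
    (sheafToPresheaf J (Type u) ⋙ (evaluation Cᵒᵖ (Type u)).obj c))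

theorem exists_pair (X Y : Sheaf J (Type u)) {c : C} (x : X.obj.obj (op c))
    (y : Y.obj.obj (op c)) : ∃ z : (X ⨯ Y).obj.obj (op c),
      (prod.fst : X ⨯ Y ⟶ X).hom.app _ z = x ∧ (prod.snd : X ⨯ Y ⟶ Y).hom.app _ z = y := by
  let F := (sheafSections J (Type u)).obj (op c)
  have h := mapIsLimitOfPreservesOfIsLimit F (prod.fst : X ⨯ Y ⟶ X) prod.snd (prodIsProd X Y)
  let f : PUnit.{u + 1} ⟶ F.obj X := ↾ fun _ => x
  let g : PUnit.{u + 1} ⟶ F.obj Y := ↾ fun _ => y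
  let l := BinaryFan.IsLimit.lift' h f g
  exact ⟨l.1 PUnit.unit, ConcreteCategory.congr_hom l.2.1 PUnit.unit,
    ConcreteCategory.congr_hom l.2.2 PUnit.unit⟩

theorem pair_ext {X Y : Sheaf J (Type u)} {c : C} {z w : (X ⨯ Y).obj.obj (op c)}
    (h1 : (prod.fst : X ⨯ Y ⟶ X).hom.app _ z = (prod.fst : X ⨯ Y ⟶ X).hom.app _ w)
    (h2 : (prod.snd : X ⨯ Y ⟶ Y).hom.app _ z = (prod.snd : X ⨯ Y ⟶ Y).hom.app _ w) : z = w := by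
  let F := (sheafSections J (Type u)).obj (op c)
  have h := mapIsLimitOfPreservesOfIsLimit F (prod.fst : X ⨯ Y ⟶ X) prod.snd (prodIsProd X Y)
  let f : PUnit.{u + 1} ⟶ F.obj (X ⨯ Y) := ↾ fun _ => z
  let g : PUnit.{u + 1} ⟶ F.obj (X ⨯ Y) := ↾ fun _ => w
  have : f = g := BinaryFan.IsLimit.hom_ext h
    (ConcreteCategory.hom_ext _ _ fun _ => h1) (ConcreteCategory.hom_ext _ _ fun _ => h2)
  exact ConcreteCategory.congr_hom this PUnit.unit

theorem subsingleton_terminal_section {c : C} (s t : (⊤_ (Sheaf J (Type u))).obj.obj (op c)) :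
    s = t := by
  have h := terminalIsTerminal.isTerminalObj ((sheafSections J (Type u)).obj (op c)) _
  let f : PUnit.{u + 1} ⟶ ((sheafSections J (Type u)).obj (op c)).obj (⊤_ _) := ↾ fun _ => s
  let g : PUnit.{u + 1} ⟶ ((sheafSections J (Type u)).obj (op c)).obj (⊤_ _) := ↾ fun _ => t
  exact ConcreteCategory.congr_hom (h.hom_ext f g) PUnit.unit

theorem nonempty_terminal_section (c : C) : Nonempty ((⊤_ (Sheaf J (Type u))).obj.obj (op c)) := by
  have h := terminalIsTerminal.isTerminalObj ((sheafSections J (Type u)).obj (op c)) _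
  exact ⟨h.from PUnit.{u + 1} PUnit.unit⟩

theorem limit_section_ext {K : Type} [SmallCategory K] (F : K ⥤ Sheaf J (Type u)) {c : C}
    {s t : (limit F).obj.obj (op c)}
    (h : ∀ k, (limit.π F k).hom.app _ s = (limit.π F k).hom.app _ t) : s = t := by
  let G := (sheafSections J (Type u)).obj (op c)
  have hl := isLimitOfPreserves G (limit.isLimit F)
  let f : PUnit.{u + 1} ⟶ G.obj (limit F) := ↾ fun _ => s
  let g : PUnit.{u + 1} ⟶ G.obj (limit F) := ↾ fun _ => t
  have : f = g := hl.hom_ext fun k => ConcreteCategory.hom_ext _ _ fun _ => h k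
  exact ConcreteCategory.congr_hom this PUnit.unit

theorem exists_limit_section {X : ℕ → Sheaf J (Type u)} (f : ∀ n, X (n + 1) ⟶ X n) {c : C}
    (x : ∀ n, (X n).obj.obj (op c)) (hx : ∀ n, (f n).hom.app _ (x (n + 1)) = x n) :
    ∃ s : (limit (Functor.ofOpSequence f)).obj.obj (op c),
      ∀ n, (limit.π (Functor.ofOpSequence f) (op n)).hom.app _ s = x n := by
  let G := (sheafSections J (Type u)).obj (op c)
  have hl := isLimitOfPreserves G (limit.isLimit (Functor.ofOpSequence f))
  let s : Cone (Functor.ofOpSequence f ⋙ G) := ⟨PUnit.{u + 1}, NatTrans.ofOpSequence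
    (fun n => ↾ fun _ => x n) (fun n => by
      apply ConcreteCategory.hom_ext
      intro _
      change x n = G.map ((Functor.ofOpSequence f).map _) (x (n + 1))
      rw [Functor.ofOpSequence_map_homOfLE_succ]
      exact (hx n).symm)⟩
  exact ⟨hl.lift s PUnit.unit, fun n =>
    ConcreteCategory.congr_hom (hl.fac s (op n)) PUnit.unit⟩

/-- A colimit of sheaves is the sheafification of the presheaf colimit. The unit of sheafification
is locally surjective, and sections of the presheaf colimit come from a stage. -/
theorem exists_local_section {K : Type} [SmallCategory K] (F : K ⥤ Sheaf J (Type u))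
    [HasColimit F] {c : C} (s : (colimit F).obj.obj (op c)) :
    ∃ R ∈ J c, ∀ ⦃d : C⦄ (f : d ⟶ c), R f → ∃ (k : K) (t : (F.obj k).obj.obj (op d)),
      (colimit.ι F k).hom.app _ t = (colimit F).obj.map f.op s := by
  let E := colimit.cocone (F ⋙ sheafToPresheaf J (Type u))
  have hE : IsColimit E := colimit.isColimit _
  let e := (Sheaf.isColimitSheafifyCocone E hE).coconePointUniqueUpToIso (colimit.isColimit F)
  let ψ : sheafify J E.pt ⟶ (colimit F).obj := e.hom.hom
  let φ : E.pt ⟶ (colimit F).obj := toSheafify J E.pt ≫ ψ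
  have hφ : Presheaf.IsLocallySurjective J φ := by
    have : IsIso ψ := inferInstanceAs (IsIso ((sheafToPresheaf J _).map e.hom))
    infer_instance
  refine ⟨_, Presheaf.imageSieve_mem J φ s, ?_⟩
  rintro d f ⟨t, ht⟩
  obtain ⟨k, t, rfl⟩ := Types.jointly_surjective_of_isColimit
    (isColimitOfPreserves ((evaluation _ _).obj (op d)) hE) t
  refine ⟨k, t, ?_⟩
  rw [← ht]
  have h : E.ι.app k ≫ φ = (colimit.ι F k).hom := by
    have h1 := (Sheaf.isColimitSheafifyCocone E hE).comp_coconePointUniqueUpToIso_hom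
      (colimit.isColimit F) k
    have h2 := congrArg (·.hom) h1
    refine Eq.trans ?_ h2
    refine (Category.assoc _ _ _).symm.trans ?_
    exact congrArg (· ≫ ψ) (Sheaf.sheafifyCocone_ι_app_val E k).symm
  rw [← h]
  rfl

end SheafSections

/-! ### Points, and what they determine -/

section Points

variable {C : Type u} [SmallCategory C] {S : ConcreteSite C} {M : MorphismProperty C}

/-- The factorization property passes from the generating families to all covering sieves by
induction on their generation. It is used for `W = star` and `W = V`: over these objects, whatever
holds locally holds globally. -/
theorem ConcreteSite.mem_of_mem_toGrothendieck {W : C}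
    (hW : ∀ (c : C) (R : Presieve c), R ∈ S.cov c → ∀ f : W ⟶ c, Sieve.generate R f)
    {c : C} {R : Sieve c} (hR : R ∈ S.cov.toGrothendieck c) (f : W ⟶ c) : R f := by
  have hR' : S.cov.Saturate c R := hR
  clear hR
  induction hR' with
  | of c R h => exact hW c R h f
  | top c => trivial
  -- Since `f` lies in the first sieve, the pullback of the second along `f` contains the identity
  -- of `W`.
  | transitive c R T _ _ ih1 ih2 => simpa using ih2 (ih1 f) (𝟙 W)

theorem ConcreteSite.mem_of_mem_toGrothendieck_star
    {c : C} {R : Sieve c} (hR : R ∈ S.cov.toGrothendieck c) (p : S.star ⟶ c) : R p := by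
  refine S.mem_of_mem_toGrothendieck (fun c R hR p => ?_) hR p
  obtain ⟨d, f, q, hf, rfl⟩ := S.cov_points c R hR p
  exact ⟨d, q, f, hf, rfl⟩

/-- Sections of `X` are determined by their values at points. -/
def SeparatedByPoints (S : ConcreteSite C) (X : Cᵒᵖ ⥤ Type u) : Prop :=
  ∀ ⦃c : C⦄ (s t : X.obj (op c)),
    (∀ p : S.star ⟶ c, X.map p.op s = X.map p.op t) → s = t

/-- Without points the identity of `c` has empty image, so axiom (iii) puts it below `0 ⟶ c`. -/
theorem nonempty_hom_zero (hM : Admissible S M) {c : C} (h : (S.star ⟶ c) → False) :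
    Nonempty (c ⟶ S.zero) := by
  obtain ⟨f, -⟩ := hM.reflects (𝟙 c) (S.zeroInitial.to c) (hM.iso _ inferInstance)
    (hM.zero_mem c) (fun _ ⟨p, _⟩ => (h p).elim)
  exact ⟨f⟩

theorem isSub_le (hM : Admissible S M) {c : C} {U V : Sieve c} (hU : IsSub M U) (hV : IsSub M V)
    (h : ∀ p : S.star ⟶ c, U p → V p) : U ≤ V := by
  obtain ⟨b, m, hm, rfl⟩ := hU
  obtain ⟨b', m', hm', rfl⟩ := hV
  refine (sieveOf_le_iff _ _).2 (hM.reflects m m' hm hm' ?_)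
  rintro _ ⟨q, rfl⟩
  exact h _ ⟨q, rfl⟩

theorem isSub_ext (hM : Admissible S M) {c : C} {U V : Sieve c} (hU : IsSub M U) (hV : IsSub M V)
    (h : ∀ p : S.star ⟶ c, U p ↔ V p) : U = V :=
  le_antisymm (isSub_le hM hU hV fun p => (h p).1) (isSub_le hM hV hU fun p => (h p).2)

theorem eq_botSection_of_points (hM : Admissible S M) (h0 : ∀ c : C, M (S.zeroInitial.to c))
    (X : Sheaf S.cov.toGrothendieck (Type u)) {c : C} (s : PartialSection M X.obj c)
    (h : ∀ p : S.star ⟶ c, ¬ s.dom p) : s = botSection h0 X c := by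
  refine eq_botSection h0 X s (isSub_ext hM s.isSub ⟨_, _, h0 c, rfl⟩ fun p => ?_)
  exact ⟨fun hp => (h p hp).elim, fun ⟨k, _⟩ => (S.no_points_zero k).elim⟩

end Points

/-! ### Admissibility of the class of monos on the combined site -/

namespace Comb

variable {C : Type u} [SmallCategory C] {S : ConcreteSite C} {M : MorphismProperty C}

/-- The point of `X` as a map from the terminal object. -/
def pt {X : Comb S} (x : Pt X) : (of S.star : Comb S) ⟶ X := const _ x

theorem exists_pt {X : Comb S} (p : (of S.star : Comb S) ⟶ X) : ∃ x : Pt X, p = pt x :=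
  ⟨p.toFun (𝟙 S.star : S.star ⟶ S.star), hom_ext fun y => by
    have : y = (𝟙 S.star : S.star ⟶ S.star) := S.starTerminal.hom_ext _ _
    rw [this]
    rfl⟩

theorem pt_injective {X : Comb S} {x y : Pt X} (h : pt x = pt y) : x = y :=
  congrFun (congrArg Hom.toFun h) (𝟙 S.star : S.star ⟶ S.star)

/-- Apart from the case without points, both subobjects come either from `C`, where axiom (iii)
applies, or from shifts of `V`, which are compared by their least values. -/
theorem reflects (hM : Admissible S M) {X Y Z : Comb S} (m : X ⟶ Z) (m' : Y ⟶ Z)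
    (hm : adm S M m) (hm' : adm S M m') (h : ∀ x, ∃ y, m'.toFun y = m.toFun x) :
    ∃ f : X ⟶ Y, f ≫ m' = m := by
  by_cases hX : Nonempty (Pt X)
  · rcases X with b | _ <;> rcases Y with b' | _ <;> rcases Z with c | _
    · obtain ⟨m, hm, rfl⟩ := hm
      obtain ⟨m', hm', rfl⟩ := hm'
      obtain ⟨f, hf⟩ := hM.reflects m m' hm hm' (by
        rintro _ ⟨q, rfl⟩
        exact h q)
      exact ⟨incl f, by rw [← incl_comp, hf]⟩
    · obtain ⟨hb⟩ := hm
      exact (isEmpty_of_isInitial hb hX.some).elim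
    · exact hm'.elim
    · obtain ⟨hb⟩ := hm
      exact (isEmpty_of_isInitial hb hX.some).elim
    · exact hm.elim
    · obtain ⟨hb⟩ := hm'
      exact (isEmpty_of_isInitial hb (h hX.some).choose).elim
    · exact hm.elim
    · obtain ⟨n, rfl⟩ := hm
      obtain ⟨k, rfl⟩ := hm'
      -- The least value of the first shift, its value `n` at `0`, is attained by the second one,
      -- all of whose values are at least `k`.
      have hkn : k ≤ n := by
        obtain ⟨y, hy⟩ := h ⟨0⟩
        have h1 : y.down + k = 0 + n := congrArg ULift.down hy
        have h2 : (k : ℕ∞) ≤ n := by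
          rw [← zero_add (n : ℕ∞), ← h1]
          exact le_add_self
        exact_mod_cast h2
      refine ⟨shift (n - k), hom_ext fun x => congrArg ULift.up ?_⟩
      change x.down + (n - k : ℕ) + k = x.down + n
      rw [add_assoc, ← Nat.cast_add, Nat.sub_add_cancel hkn]
  · obtain ⟨k⟩ := exists_to_zero hM fun x => hX ⟨x⟩
    exact ⟨k ≫ (site S).zeroInitial.to Y, hom_ext fun x => (hX ⟨x⟩).elim⟩

theorem image_eq {X Y : Comb S} (m : X ⟶ Y) :
    (site S).image m = {p | ∃ x, pt (m.toFun x) = p} := by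
  ext p
  constructor
  · rintro ⟨q, rfl⟩
    obtain ⟨x, rfl⟩ := exists_pt q
    exact ⟨x, rfl⟩
  · rintro ⟨x, rfl⟩
    exact ⟨pt x, rfl⟩

theorem image_subset_iff {X Y Z : Comb S} {m : X ⟶ Z} {m' : Y ⟶ Z} :
    (site S).image m ⊆ (site S).image m' ↔ ∀ x, ∃ y, m'.toFun y = m.toFun x := by
  rw [image_eq, image_eq]
  constructor
  · intro h x
    obtain ⟨y, hy⟩ := h ⟨x, rfl⟩
    exact ⟨y, pt_injective hy⟩
  · rintro h _ ⟨x, rfl⟩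
    obtain ⟨y, hy⟩ := h x
    exact ⟨y, congrArg pt hy⟩

/-- A point of an object of `C` as a point of the corresponding object of `C + V₀`. -/
def ofPoint {c : C} (p : S.star ⟶ c) : (site S).star ⟶ (of c : Comb S) := pt (X := of c) p

theorem ofPoint_injective {c : C} : Function.Injective (ofPoint (S := S) (c := c)) :=
  fun _ _ h => pt_injective (X := of c) h

theorem image_incl {b c : C} (m : b ⟶ c) :
    (site S).image (incl m) = ofPoint '' S.image m := by
  rw [image_eq]
  ext p
  constructor
  · rintro ⟨x, rfl⟩
    exact ⟨_, ⟨x, rfl⟩, rfl⟩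
  · rintro ⟨_, ⟨x, rfl⟩, rfl⟩
    exact ⟨x, rfl⟩

theorem image_incl_eq_iUnion_iff {a c : C} {b : ℕ → C} (k : a ⟶ c) (m : ∀ n, b n ⟶ c) :
    (site S).image (incl k) = ⋃ n, (site S).image (incl (m n)) ↔
      S.image k = ⋃ n, S.image (m n) := by
  simp only [image_incl]
  rw [← Set.image_iUnion]
  exact (Set.image_injective.2 ofPoint_injective).eq_iff

/-- A subobject of `V` in the class is empty or of the form `x ≥ k` with `k` natural. The smallest
such `k` that occurs gives the largest member, so axioms (iv) and (v) on `V` reduce to a union that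
is already attained. -/
theorem chain_attained (X : ℕ → Comb S) (m : ∀ n, X n ⟶ vert)
    (hm : ∀ n, adm S M (m n)) :
    ∃ N, ∀ n, (site S).image (m n) ⊆ (site S).image (m N) := by
  classical
  have hdesc : ∀ n, (Pt (X n) → False) ∨
      ∃ k : ℕ, Set.range (m n).toFun = {x | (k : ℕ∞) ≤ x.down} := by
    intro n
    have hn := hm n
    generalize m n = m' at hn
    generalize X n = Y at m' hn
    cases Y with
    | of b =>
      obtain ⟨hb⟩ := hn
      exact Or.inl fun p => isEmpty_of_isInitial hb p
    | vert =>
      obtain ⟨k, rfl⟩ := hn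
      refine Or.inr ⟨k, ?_⟩
      ext x
      constructor
      · rintro ⟨y, rfl⟩
        exact (le_add_self : (k : ℕ∞) ≤ y.down + k)
      · intro hx
        exact ⟨⟨x.down - k⟩, ULift.ext _ _ (tsub_add_cancel_of_le hx)⟩
  -- If no lower bound `k` occurs, all members are empty and any index will do.
  by_cases h : ∃ k : ℕ, ∃ n, Set.range (m n).toFun = {x | (k : ℕ∞) ≤ x.down}
  · obtain ⟨N, hN⟩ := Nat.find_spec h
    refine ⟨N, fun n => image_subset_iff.2 fun x => ?_⟩
    change (m n).toFun x ∈ Set.range (m N).toFun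
    rw [hN]
    rcases hdesc n with h1 | ⟨k, hk⟩
    · exact (h1 x).elim
    · have hx : (k : ℕ∞) ≤ ((m n).toFun x).down := by
        have : (m n).toFun x ∈ Set.range (m n).toFun := ⟨x, rfl⟩
        rw [hk] at this
        exact this
      refine le_trans ?_ hx
      exact_mod_cast Nat.find_min' h ⟨n, hk⟩
  · refine ⟨0, fun n => image_subset_iff.2 fun x => ?_⟩
    rcases hdesc n with h1 | ⟨k, hk⟩
    · exact (h1 x).elim
    · exact (h ⟨k, n, hk⟩).elim

/-- No map from `V` to an object of `C` is in the class, so a chain over `of c` lives in `C`. The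
`eqToHom` records the equality of domains until it can be substituted. -/
theorem exists_incl_chain {c : C} {X : ℕ → Comb S} {m : ∀ n, X n ⟶ of c}
    (hm : ∀ n, adm S M (m n)) :
    ∃ (b : ℕ → C) (m' : ∀ n, b n ⟶ c), (∀ n, M (m' n)) ∧
      ∀ n, ∃ (h : X n = of (b n)), m n = eqToHom h ≫ incl (m' n) := by
  have : ∀ n, ∃ (b : C) (m' : b ⟶ c), M m' ∧ ∃ (h : X n = of b), m n = eqToHom h ≫ incl m' := by
    intro n
    have hn := hm n
    generalize m n = k at hn
    generalize X n = Y at k hn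
    cases Y with
    | of b =>
      obtain ⟨m', hm', rfl⟩ := hn
      exact ⟨b, m', hm', rfl, by simp⟩
    | vert => exact hn.elim
  choose b m' h1 h2 using this
  exact ⟨b, m', h1, h2⟩

theorem site_admissible (hM : Admissible S M) : Admissible (site S) (adm S M) where
  toPreAdmissible := adm_preAdmissible hM
  zero_mem := adm_zero hM
  reflects m m' hm hm' h := reflects hM m m' hm hm' (image_subset_iff.1 h)
  chain_sup := by
    rintro (c | _) X m hm hle
    · obtain ⟨b, m', hm', hX⟩ := exists_incl_chain hm
      obtain rfl : X = fun n => of (b n) := funext fun n => (hX n).choose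
      obtain rfl : m = fun n => incl (m' n) := funext fun n => by
        obtain ⟨_, h⟩ := hX n
        simpa using h
      obtain ⟨a, k, hk, h⟩ := hM.chain_sup c b m' hm' fun n => by
        obtain ⟨f, hf⟩ := hle n
        obtain ⟨f, rfl⟩ := exists_incl f
        rw [← incl_comp] at hf
        exact ⟨f, incl_injective hf⟩
      exact ⟨of a, incl k, ⟨k, hk, rfl⟩, (image_incl_eq_iUnion_iff k m').2 h⟩
    · obtain ⟨N, hN⟩ := chain_attained X m hm
      exact ⟨X N, m N, hm N, (Set.subset_iUnion (fun n => (site S).image (m n)) N).antisymm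
        (Set.iUnion_subset hN)⟩
  chain_cover := by
    rintro (c | _) X m hm hle Y k hk hkm
    · obtain ⟨b, m', hm', hX⟩ := exists_incl_chain hm
      obtain rfl : X = fun n => of (b n) := funext fun n => (hX n).choose
      obtain rfl : m = fun n => incl (m' n) := funext fun n => by
        obtain ⟨_, h⟩ := hX n
        simpa using h
      cases Y with
      | vert => exact hk.elim
      | of a =>
        obtain ⟨k, hk, rfl⟩ := hk
        obtain ⟨R, hR, hRm⟩ := hM.chain_cover c b m' hm' (fun n => by
          obtain ⟨f, hf⟩ := hle n
          obtain ⟨f, rfl⟩ := exists_incl f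
          rw [← incl_comp] at hf
          exact ⟨f, incl_injective hf⟩) a k hk ((image_incl_eq_iUnion_iff k m').1 hkm)
        refine ⟨_, ⟨R, hR, rfl⟩, ?_⟩
        rintro _ _ ⟨hf⟩
        obtain ⟨n, l, hl⟩ := hRm _ hf
        exact ⟨n, incl l, by rw [← incl_comp, hl, incl_comp]⟩
    · obtain ⟨N, hN⟩ := chain_attained X m hm
      obtain ⟨f, hf⟩ := reflects hM k (m N) hk (hm N) (image_subset_iff.1 (by
        rw [hkm]
        exact Set.iUnion_subset hN))
      -- The union is below the stage `N` that attains it, so the identity already covers as axiom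
      -- (v) requires.
      refine ⟨_, singleton_mem Y, ?_⟩
      rintro _ _ ⟨⟩
      exact ⟨N, f, by rw [hf, Category.id_comp]⟩

end Comb

/-! ### Partial sections at points, and limits of chains of partial sections -/

section Lifting

variable {C : Type u} [SmallCategory C] {S : ConcreteSite C} {M : MorphismProperty C}

namespace PartialSection

variable {X Y : Cᵒᵖ ⥤ Type u} {c d : C}

theorem val_eq_of_eq {s t : PartialSection M X c} (h : s = t) {f : d ⟶ c} (hs : s.dom f)
    (ht : t.dom f) : s.val f hs = t.val f ht := by
  subst h; rfl

theorem val_comp (s : PartialSection M X c) {e : C} {f : d ⟶ c} {g : e ⟶ d} {h : e ⟶ c}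
    (e1 : g ≫ f = h) (hf : s.dom f) (hh : s.dom h) : s.val h hh = X.map g.op (s.val f hf) := by
  subst e1
  exact s.compat f g hf

theorem ext_of_total {s t : PartialSection M X c} (hs : s.dom (𝟙 c)) (ht : t.dom (𝟙 c))
    (h : s.val (𝟙 c) hs = t.val (𝟙 c) ht) : s = t := by
  have hs' : ∀ {e : C} (f : e ⟶ c), s.dom f := fun f => by
    simpa using s.dom.downward_closed hs f
  have ht' : ∀ {e : C} (f : e ⟶ c), t.dom f := fun f => by
    simpa using t.dom.downward_closed ht f
  refine ext' (Sieve.ext fun e f => ⟨fun _ => ht' f, fun _ => hs' f⟩) fun e f hf hf' => ?_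
  rw [s.val_comp (Category.comp_id f) hs, t.val_comp (Category.comp_id f) ht, h]

theorem restrict_dom_id (hM : StableMonos M) (s : PartialSection M X c) (f : d ⟶ c) :
    (s.restrict hM f).dom (𝟙 d) ↔ s.dom f := by
  change s.dom (𝟙 d ≫ f) ↔ _
  rw [Category.id_comp]

theorem restrict_val_id (hM : StableMonos M) (s : PartialSection M X c) (f : d ⟶ c)
    (h : (s.restrict hM f).dom (𝟙 d)) (h' : s.dom f) :
    (s.restrict hM f).val (𝟙 d) h = s.val f h' :=
  s.val_congr (Category.id_comp f) _ _

/-- The restrictions of two partial sections along `f` and `g` are equal if both are total, with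
the same value. -/
theorem restrict_eq_restrict (hM : StableMonos M) {c' : C} {s : PartialSection M X c}
    {t : PartialSection M X c'} {f : d ⟶ c} {g : d ⟶ c'} (hs : s.dom f) (ht : t.dom g)
    (h : s.val f hs = t.val g ht) : s.restrict hM f = t.restrict hM g :=
  ext_of_total ((restrict_dom_id hM s f).2 hs) ((restrict_dom_id hM t g).2 ht)
    ((restrict_val_id hM s f _ hs).trans (h.trans (restrict_val_id hM t g _ ht).symm))

theorem dom_iff_of_restrict_eq (hM : StableMonos M) {c' : C} {s : PartialSection M X c}
    {t : PartialSection M X c'} {f : d ⟶ c} {g : d ⟶ c'}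
    (h : s.restrict hM f = t.restrict hM g) : s.dom f ↔ t.dom g := by
  rw [← restrict_dom_id hM s f, ← restrict_dom_id hM t g, h]

theorem val_eq_of_restrict_eq (hM : StableMonos M) {c' : C} {s : PartialSection M X c}
    {t : PartialSection M X c'} {f : d ⟶ c} {g : d ⟶ c'}
    (h : s.restrict hM f = t.restrict hM g) (hs : s.dom f) (ht : t.dom g) :
    s.val f hs = t.val g ht :=
  (restrict_val_id hM s f ((restrict_dom_id hM s f).2 hs) hs).symm.trans
    ((val_eq_of_eq h _ _).trans (restrict_val_id hM t g ((restrict_dom_id hM t g).2 ht) ht))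

end PartialSection

open PartialSection

variable (S) in
/-- A partial section over the terminal object that is defined at its point is total. -/
theorem dom_id_of_dom {X : Cᵒᵖ ⥤ Type u} {s : PartialSection M X S.star} {p : S.star ⟶ S.star}
    (h : s.dom p) : s.dom (𝟙 _) := by
  rwa [S.starTerminal.hom_ext (𝟙 _) p]

/-- The terminal object has a single point, so a partial section over it is total or has no point in
its domain. The points of `L X` are therefore those of `X` together with `⊥`, which is the flat
order used below. -/
theorem restrict_eq_botSection (hA : Admissible S M) (h0 : ∀ c : C, M (S.zeroInitial.to c))
    (X : Sheaf S.cov.toGrothendieck (Type u)) {c : C} (s : PartialSection M X.obj c)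
    {p : S.star ⟶ c} (hp : ¬ s.dom p) :
    s.restrict hA.toStableMonos p = botSection h0 X S.star := by
  refine eq_botSection_of_points hA h0 X _ fun q hq => hp ?_
  exact (restrict_dom_id hA.toStableMonos s p).1 (dom_id_of_dom S hq)

theorem not_dom_botSection (h0 : ∀ c : C, M (S.zeroInitial.to c))
    (X : Sheaf S.cov.toGrothendieck (Type u)) {c : C} (p : S.star ⟶ c) :
    ¬ (botSection h0 X c).dom p :=
  fun ⟨k, _⟩ => S.no_points_zero k

theorem restrict_botSection (hA : Admissible S M) (h0 : ∀ c : C, M (S.zeroInitial.to c))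
    (X : Sheaf S.cov.toGrothendieck (Type u)) {c : C} (p : S.star ⟶ c) :
    (botSection h0 X c).restrict hA.toStableMonos p = botSection h0 X S.star :=
  restrict_eq_botSection hA h0 X _ (not_dom_botSection h0 X p)

theorem map_botSection (h0 : ∀ c : C, M (S.zeroInitial.to c))
    {X Y : Sheaf S.cov.toGrothendieck (Type u)} (φ : X ⟶ Y) (c : C) :
    (botSection h0 X c).map φ.hom = botSection h0 Y c :=
  eq_botSection h0 Y _ rfl

/-- Points determine the domain by axiom (iii), and then the values by separation of `X`. -/
theorem SeparatedByPoints.liftPresheaf (hA : Admissible S M) {X : Cᵒᵖ ⥤ Type u}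
    (hX : SeparatedByPoints S X) : SeparatedByPoints S (liftPresheaf hA.toStableMonos X) := by
  intro c s t h
  have h' : ∀ p : S.star ⟶ c, s.restrict hA.toStableMonos p = t.restrict hA.toStableMonos p := h
  have hdom : s.dom = t.dom := isSub_ext hA s.isSub t.isSub fun p =>
    dom_iff_of_restrict_eq _ (h' p)
  refine ext' hdom fun d f hf hf' => hX _ _ fun p => ?_
  rw [← s.compat, ← t.compat]
  exact val_eq_of_restrict_eq _ (h' _) _ _

/-- A sequence of sections of `X` that increases at each point, for the flat order on the set of
points of `X` with least element `b`, has a limit. -/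
def HasFlatLimits (S : ConcreteSite C) (X : Cᵒᵖ ⥤ Type u) (b : X.obj (op S.star)) : Prop :=
  ∀ (c : C) (s : ℕ → X.obj (op c)),
    (∀ n (p : S.star ⟶ c), X.map p.op (s n) ≠ b → X.map p.op (s (n + 1)) = X.map p.op (s n)) →
    ∃ t : X.obj (op c), ∀ p : S.star ⟶ c, ∃ k, ∀ n, k ≤ n → X.map p.op t = X.map p.op (s n)

/-- The domains of the chain increase, and its values agree wherever two of them are defined. The
limit has as domain the union of the domains, and as value the glued values. -/
theorem hasFlatLimits_liftPresheaf (hA : Admissible S M) (h0 : ∀ c : C, M (S.zeroInitial.to c))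
    (X : Sheaf S.cov.toGrothendieck (Type u)) (hX : SeparatedByPoints S X.obj) :
    HasFlatLimits S (liftPresheaf hA.toStableMonos X.obj) (botSection h0 X S.star) := by
  intro c s hs
  have hM := hA.toStableMonos
  change ℕ → PartialSection M X.obj c at s
  have hs1 : ∀ n (p : S.star ⟶ c), (s n).dom p → (s (n + 1)).restrict hM p = (s n).restrict hM p :=
    fun n p hp => hs n p fun h => not_dom_botSection h0 X (𝟙 S.star)
      (h ▸ (restrict_dom_id hM (s n) p).2 hp)
  have hs2 : ∀ (p : S.star ⟶ c) (n : ℕ), (s n).dom p → ∀ k, n ≤ k →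
      (s k).restrict hM p = (s n).restrict hM p := by
    intro p n hp k hk
    induction k, hk using Nat.le_induction with
    | base => rfl
    | succ k _ ih => exact (hs1 k p ((dom_iff_of_restrict_eq _ ih).2 hp)).trans ih
  have hval : ∀ (p : S.star ⟶ c) (n k : ℕ) (hn : (s n).dom p) (hk : (s k).dom p),
      (s n).val p hn = (s k).val p hk := by
    intro p n k hn hk
    rcases le_total n k with h | h
    · exact (val_eq_of_restrict_eq _ (hs2 p n hn k h) hk hn).symm
    · exact val_eq_of_restrict_eq _ (hs2 p k hk n h) hn hk
  -- Agreement at points extends to all common elements of the domains, because `X` is separated by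
  -- points.
  have hval' : ∀ {e : C} (f : e ⟶ c) (n k : ℕ) (hn : (s n).dom f) (hk : (s k).dom f),
      (s n).val f hn = (s k).val f hk := by
    intro e f n k hn hk
    refine hX _ _ fun p => ?_
    rw [← (s n).compat, ← (s k).compat]
    exact hval _ _ _ _ _
  choose b m hm hsm using fun n => (s n).isSub
  have hle : ∀ n, ∃ f : b n ⟶ b (n + 1), f ≫ m (n + 1) = m n := by
    intro n
    rw [← sieveOf_le_iff, ← hsm, ← hsm]
    exact isSub_le hA (s n).isSub (s (n + 1)).isSub fun p hp =>
      (dom_iff_of_restrict_eq _ (hs1 n p hp)).2 hp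
  -- Axiom (iv) provides the domain of the limit. Axiom (v) covers it by pieces that lie in finite
  -- stages, on which the values are known.
  obtain ⟨b', m', hm', him⟩ := hA.chain_sup c b m hm hle
  obtain ⟨R, hR, hRm⟩ := hA.chain_cover c b m hm hle b' m' hm' him
  have hRs : ∀ ⦃d : C⦄ (f : d ⟶ b'), R f → ∃ n, (s n).dom (f ≫ m') := by
    intro d f hf
    obtain ⟨n, k, hk⟩ := hRm f hf
    exact ⟨n, by rw [hsm]; exact ⟨k, hk⟩⟩
  choose N hN using hRs
  have hsheaf : Presieve.IsSheaf S.cov.toGrothendieck X.obj :=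
    (isSheaf_iff_isSheaf_of_type _ _).1 X.property
  rw [Presieve.isSheaf_coverage] at hsheaf
  obtain ⟨y, hy, -⟩ := hsheaf R hR (fun d f hf => (s (N f hf)).val (f ≫ m') (hN f hf)) (by
    intro d d' e g g' f f' hf hf' h
    have h1 : g ≫ f ≫ m' = g' ≫ f' ≫ m' := by rw [reassoc_of% h]
    have h2 := (s (N f hf)).dom.downward_closed (hN f hf) g
    have h3 := (s (N f' hf')).dom.downward_closed (hN f' hf') g'
    refine ((s (N f hf)).val_comp rfl (hN f hf) h2).symm.trans ?_
    refine Eq.trans ?_ ((s (N f' hf')).val_comp rfl (hN f' hf') h3)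
    exact (hval' _ _ _ h2 (h1 ▸ h3)).trans ((s (N f' hf')).val_congr h1 _ _))
  have hmono := hA.mono m' hm'
  let t := (equivOfMono (X := X.obj) m' hm').symm y
  have ht : (equivOfMono (X := X.obj) m' hm') t = y := Equiv.apply_symm_apply _ _
  have htm : t.1.dom m' := by rw [t.2]; exact ⟨𝟙 _, Category.id_comp _⟩
  refine ⟨t.1, fun p => ?_⟩
  -- A point in the union lies in a member of the cover, hence in the stage `N` chosen for that
  -- member, and the chain is constant there from `N` on. Outside the union every stage has the
  -- value `⊥`.
  by_cases hp : t.1.dom p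
  · have hp' := hp
    rw [t.2] at hp'
    obtain ⟨q, rfl⟩ := hp'
    obtain ⟨d, f, r, hf, rfl⟩ := S.cov_points b' R hR q
    have hq : (s (N f hf)).dom ((r ≫ f) ≫ m') := by
      rw [Category.assoc]
      exact (s (N f hf)).dom.downward_closed (hN f hf) r
    have hv : t.1.val ((r ≫ f) ≫ m') hp = (s (N f hf)).val ((r ≫ f) ≫ m') hq := by
      rw [t.1.val_comp rfl htm, (s (N f hf)).val_comp (Category.assoc _ _ _).symm (hN f hf)]
      change X.obj.map (r ≫ f).op ((equivOfMono (X := X.obj) m' hm') t) = _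
      rw [ht, op_comp, Functor.map_comp_apply]
      exact congrArg _ (hy f hf)
    exact ⟨N f hf, fun n hn => (restrict_eq_restrict _ hp hq hv).trans (hs2 _ _ hq n hn).symm⟩
  · refine ⟨0, fun n _ => ?_⟩
    refine (restrict_eq_botSection hA h0 X t.1 hp).trans
      (restrict_eq_botSection hA h0 X (s n) fun h => hp ?_).symm
    have h1 : p ∈ ⋃ n, S.image (m n) := by
      rw [hsm] at h
      obtain ⟨q, hq⟩ := h
      exact Set.mem_iUnion.2 ⟨n, q, hq⟩
    rw [← him] at h1
    obtain ⟨q, hq⟩ := h1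
    rw [t.2]
    exact ⟨q, hq⟩

end Lifting

/-! ### Truncations between the iterates, `ω` and `ω̄` -/

section Chains

variable {C : Type u} [SmallCategory C] {S : ConcreteSite C} {M : MorphismProperty C}
  (hM : PreAdmissible S.cov M) (h0 : ∀ c : C, M (S.zeroInitial.to c))

/-- The composite through `Lᵇ1` truncates at `b`. This loses nothing unless `b` is smaller than both
ends, the case that the hypothesis excludes. -/
theorem iterMap_comp {a b c : ℕ} (h : a ≤ b ∨ c ≤ b) :
    iterMap hM h0 a b ≫ iterMap hM h0 b c = iterMap hM h0 a c := by
  induction c generalizing a b with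
  | zero => exact terminal.hom_ext _ _
  | succ c ih =>
    cases a with
    | zero =>
      cases b with
      | zero => rw [iterMap_self, Category.id_comp]
      | succ b => exact bot_map hM h0 _
    | succ a =>
      cases b with
      | zero => omega
      | succ b => exact ((lift hM).map_comp _ _).symm.trans (congrArg _ (ih (by omega)))

theorem iterMap_succ_self (n : ℕ) : iterMap hM h0 (n + 1) n = down hM n := by
  rw [← iterMap_down, iterMap_self, Category.id_comp]

theorem iterMap_self_succ (n : ℕ) : iterMap hM h0 n (n + 1) = up hM h0 n := by
  rw [← up_iterMap, iterMap_self, Category.comp_id]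

/-- Truncation at `n` is compatible with the projections of the tower. This makes the paths in the
iterates fit together to a path in `ω̄`. -/
theorem down_iterMap_iterMap (m n : ℕ) :
    down hM m ≫ iterMap hM h0 m n ≫ iterMap hM h0 n m =
      iterMap hM h0 (m + 1) n ≫ iterMap hM h0 n m := by
  rw [← iterMap_succ_self hM h0]
  rcases le_or_gt n m with h | h
  · rw [← Category.assoc, iterMap_comp hM h0 (Or.inr h)]
  · rw [iterMap_comp hM h0 (Or.inl h.le), iterMap_self, Category.comp_id,
      iterMap_comp hM h0 (Or.inl h)]

/-- The projections `ω̄ ⟶ Lⁿ 1`. -/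
noncomputable def omegaBarπ (n : ℕ) : omegaBar hM ⟶ iter hM n :=
  limit.π (Functor.ofOpSequence (down hM)) (op n)

theorem omegaBarπ_down (n : ℕ) : omegaBarπ hM (n + 1) ≫ down hM n = omegaBarπ hM n := by
  have h := limit.w (Functor.ofOpSequence (down hM)) (homOfLE n.le_succ).op
  rw [Functor.ofOpSequence_map_homOfLE_succ] at h
  exact h

theorem omegaBarπ_iterMap {n m : ℕ} (h : n ≤ m) :
    omegaBarπ hM m ≫ iterMap hM h0 m n = omegaBarπ hM n := by
  induction m, h using Nat.le_induction with
  | base => rw [iterMap_self, Category.comp_id]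
  | succ m h ih =>
    rw [← iterMap_comp hM h0 (Or.inr h), ← Category.assoc, iterMap_succ_self, omegaBarπ_down, ih]

theorem toOmegaBar_omegaBarπ (n m : ℕ) :
    toOmegaBar hM h0 n ≫ omegaBarπ hM m = iterMap hM h0 n m :=
  toOmegaBar_π hM h0 n m

/-- The inclusions `Lⁿ 1 ⟶ ω`. -/
noncomputable def omegaι (n : ℕ) : iter hM n ⟶ omega hM h0 :=
  colimit.ι (Functor.ofSequence (up hM h0)) n

theorem up_omegaι (n : ℕ) : up hM h0 n ≫ omegaι hM h0 (n + 1) = omegaι hM h0 n := by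
  have h := colimit.w (Functor.ofSequence (up hM h0)) (homOfLE n.le_succ)
  rw [Functor.ofSequence_map_homOfLE_succ] at h
  exact h

theorem iterMap_omegaι {n m : ℕ} (h : m ≤ n) :
    iterMap hM h0 m n ≫ omegaι hM h0 n = omegaι hM h0 m := by
  induction n, h using Nat.le_induction with
  | base => rw [iterMap_self, Category.id_comp]
  | succ n h ih =>
    rw [← iterMap_comp hM h0 (Or.inl h), Category.assoc, iterMap_self_succ, up_omegaι, ih]

theorem omegaι_comparison (n : ℕ) :
    omegaι hM h0 n ≫ comparison hM h0 = toOmegaBar hM h0 n :=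
  colimit.ι_desc _ _

/-- A section of the colimit comes locally from a finite stage, and every covering sieve of the
terminal object contains its identity. -/
theorem exists_omega_star (w : (omega hM h0).obj.obj (op S.star)) :
    ∃ (n : ℕ) (u : (iter hM n).obj.obj (op S.star)), (omegaι hM h0 n).hom.app _ u = w := by
  obtain ⟨R, hR, h⟩ := exists_local_section (Functor.ofSequence (up hM h0)) w
  obtain ⟨n, u, hu⟩ := h (𝟙 _) (S.mem_of_mem_toGrothendieck_star hR (𝟙 _))
  exact ⟨n, u, hu.trans (ConcreteCategory.congr_hom ((omega hM h0).obj.map_id _) w)⟩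

end Chains

/-! ### Sections over `V`: flatness, and paths to points of `ω̄` -/

namespace Comb

variable {C : Type u} [SmallCategory C] {S : ConcreteSite C} {M : MorphismProperty C}

open PartialSection

/-- The points of `V`. -/
def vpt (x : ℕ∞) : (site S).star ⟶ (vert : Comb S) := pt (X := vert) ⟨x⟩

theorem vpt_shift (x : ℕ∞) (n : ℕ) : vpt (S := S) x ≫ shift n = vpt (x + n) := rfl

theorem vpt_surjective (p : (site S).star ⟶ vert) : ∃ x, p = vpt x := by
  obtain ⟨x, rfl⟩ := exists_pt p
  exact ⟨x.down, rfl⟩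

theorem sieveOf_shift_vpt (k : ℕ) (x : ℕ∞) :
    sieveOf (shift (S := S) k) (vpt x) ↔ (k : ℕ∞) ≤ x := by
  constructor
  · rintro ⟨q, hq⟩
    obtain ⟨y, rfl⟩ := vpt_surjective q
    rw [vpt_shift] at hq
    have : y + k = x := congrArg ULift.down (pt_injective (X := vert) hq)
    exact this ▸ le_add_self
  · intro h
    exact ⟨vpt (x - k), by rw [vpt_shift, tsub_add_cancel_of_le h]⟩

/-- A map from `V` to an object of `C` is constant, so it factors through a point, and covers
contain all points. `V` itself is covered only by its identity. -/
theorem mem_of_mem_toGrothendieck_vert {X : Comb S} {R : Sieve X}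
    (hR : R ∈ (site S).cov.toGrothendieck X) (f : vert ⟶ X) : R f := by
  refine (site S).mem_of_mem_toGrothendieck (fun X R hR f => ?_) hR f
  cases X with
  | of c =>
    obtain ⟨d, g, q, hg, hq⟩ := (site S).cov_points _ R hR (pt (f.toFun ⟨0⟩))
    refine ⟨d, (site S).starTerminal.from _ ≫ q, g, hg, ?_⟩
    rw [Category.assoc, hq]
    exact hom_ext fun x => f.isMor _ _
  | vert =>
    obtain rfl : R = _ := hR
    exact ⟨vert, f, 𝟙 _, ⟨⟩, Category.comp_id _⟩

/-- The sections of `X` over `V` are constant. -/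
def ConstantOnVert (S : ConcreteSite C) (X : (Comb S)ᵒᵖ ⥤ Type u) : Prop :=
  ∀ s : X.obj (op vert), ∃ t : X.obj (op (site S).star),
    s = X.map ((site S).starTerminal.from vert).op t

/-- Every section of `X` over `V` has the value `b` up to some natural number, and its value at
infinity from there on. -/
def FlatOnVert (S : ConcreteSite C) (X : (Comb S)ᵒᵖ ⥤ Type u)
    (b : X.obj (op (site S).star)) : Prop :=
  ∀ s : X.obj (op vert), ∃ k : ℕ, ∀ n : ℕ,
    (n < k → X.map (vpt n).op s = b) ∧ (k ≤ n → X.map (vpt n).op s = X.map (vpt ⊤).op s)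

/-- The domain of the section is empty or `x ≥ k`. In the second case its value is a section of `X`
over `V`, hence constant. -/
theorem flatOnVert_liftPresheaf (hA : Admissible (site S) (adm S M))
    (h0 : ∀ X, adm S M ((site S).zeroInitial.to X))
    (X : Sheaf (site S).cov.toGrothendieck (Type u)) (hX : ConstantOnVert S X.obj) :
    FlatOnVert S (liftPresheaf hA.toStableMonos X.obj) (botSection h0 X (site S).star) := by
  intro s
  change PartialSection (adm S M) X.obj vert at s
  have hM := hA.toStableMonos
  change ∃ k : ℕ, ∀ n : ℕ, (n < k → s.restrict hM (vpt n) = botSection h0 X (site S).star) ∧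
    (k ≤ n → s.restrict hM (vpt n) = s.restrict hM (vpt ⊤))
  obtain ⟨b, m, hm, hs⟩ := s.isSub
  cases b with
  | of b =>
    obtain ⟨hb⟩ := hm
    have h : ∀ x, s.restrict hM (vpt x) = botSection h0 X (site S).star := by
      intro x
      refine restrict_eq_botSection hA h0 X s ?_
      rw [hs]
      rintro ⟨q, -⟩
      obtain ⟨y, -⟩ := exists_pt q
      exact isEmpty_of_isInitial hb y
    exact ⟨0, fun n => ⟨fun _ => h _, fun _ => (h _).trans (h _).symm⟩⟩
  | vert =>
    obtain ⟨k, rfl⟩ := hm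
    have hk : s.dom (shift k) := by rw [hs]; exact ⟨𝟙 _, Category.id_comp _⟩
    have hdom : ∀ x : ℕ∞, s.dom (vpt x) ↔ (k : ℕ∞) ≤ x := fun x => by
      rw [hs, sieveOf_shift_vpt]
    obtain ⟨t, ht⟩ := hX (s.val _ hk)
    have hval : ∀ (x : ℕ∞) (hx : s.dom (vpt x)), s.val (vpt x) hx = t := by
      intro x hx
      have hx' : vpt (S := S) (x - k) ≫ shift k = vpt x := by
        rw [vpt_shift, tsub_add_cancel_of_le ((hdom x).1 hx)]
      rw [s.val_comp hx' hk, ht, ← Functor.map_comp_apply, ← op_comp,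
        (site S).starTerminal.hom_ext (vpt (x - k) ≫ (site S).starTerminal.from vert) (𝟙 _)]
      simp
    refine ⟨k, fun n => ⟨fun hn => restrict_eq_botSection hA h0 X s ?_, fun hn => ?_⟩⟩
    · rw [hdom]
      exact_mod_cast not_le.2 hn
    · have h1 : s.dom (vpt n) := (hdom _).2 (by exact_mod_cast hn)
      have h2 : s.dom (vpt ⊤) := (hdom _).2 le_top
      exact restrict_eq_restrict hM h1 h2 ((hval _ h1).trans (hval _ h2).symm)

theorem separatedByPoints_iter (hA : Admissible (site S) (adm S M)) (m : ℕ) :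
    SeparatedByPoints (site S) (iter hA.toPreAdmissible m).obj := by
  induction m with
  | zero => exact fun c s t _ => subsingleton_terminal_section s t
  | succ m ih => exact ih.liftPresheaf hA

/-- Induction on `m`. The path of `⊥` is constant, and the path of a total point is that of its
value, started one step later: `⊥` at `0`, and at `n + 1` the `n`-th truncation of the value. -/
theorem exists_iter_vert (hA : Admissible (site S) (adm S M))
    (h0 : ∀ X, adm S M ((site S).zeroInitial.to X)) (m : ℕ)
    (u : (iter hA.toPreAdmissible m).obj.obj (op (site S).star)) :
    ∃ w : (iter hA.toPreAdmissible m).obj.obj (op vert),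
      (iter hA.toPreAdmissible m).obj.map (vpt ⊤).op w = u ∧
      ∀ n : ℕ, (iter hA.toPreAdmissible m).obj.map (vpt n).op w =
        (iterMap hA.toPreAdmissible h0 m n ≫ iterMap hA.toPreAdmissible h0 n m).hom.app _ u := by
  induction m with
  | zero =>
    obtain ⟨w⟩ := nonempty_terminal_section (J := (site S).cov.toGrothendieck) vert
    exact ⟨w, subsingleton_terminal_section _ _, fun _ => subsingleton_terminal_section _ _⟩
  | succ m ih =>
    have hM := hA.toStableMonos
    let Z := iter hA.toPreAdmissible m
    change PartialSection (adm S M) Z.obj (site S).star at u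
    change ∃ w : PartialSection (adm S M) Z.obj vert, w.restrict hM (vpt ⊤) = u ∧
      ∀ n : ℕ, w.restrict hM (vpt n) = _
    by_cases hu : u.dom (𝟙 _)
    · obtain ⟨v, hv, hvn⟩ := ih (u.val _ hu)
      have hs : adm S M (shift 1) := ⟨1, rfl⟩
      have := hM.mono _ hs
      -- The delay: `w` is defined on `x ≥ 1`, with `w (x + 1) = v x`.
      let w := (equivOfMono (X := Z.obj) (shift (S := S) 1) hs).symm v
      have hw : ∀ x : ℕ∞, 1 ≤ x → w.1.dom (vpt x) := fun x hx => by
        rw [w.2, sieveOf_shift_vpt]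
        exact_mod_cast hx
      have hw1 : w.1.dom (shift 1) := by rw [w.2]; exact ⟨𝟙 _, Category.id_comp _⟩
      have hwv : w.1.val (shift 1) hw1 = v :=
        (equivOfMono (X := Z.obj) (shift (S := S) 1) hs).apply_symm_apply v
      have hwx : ∀ (x : ℕ∞) (h : w.1.dom (vpt (x + 1))),
          w.1.val (vpt (x + 1)) h = Z.obj.map (vpt x).op v := fun x h => by
        rw [w.1.val_comp (by rw [vpt_shift, Nat.cast_one] : vpt x ≫ shift 1 = vpt (x + 1)) hw1, hwv]
      refine ⟨w.1, ?_, fun n => ?_⟩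
      · refine ext_of_total ((restrict_dom_id hM _ _).2 (hw _ le_top)) hu ?_
        rw [restrict_val_id hM _ _ _ (hw _ le_top)]
        -- The delay does not affect the value at infinity, as `∞ + 1 = ∞`.
        exact (hwx ⊤ (hw _ le_top)).trans hv
      · cases n with
        | zero =>
          refine restrict_eq_botSection hA h0 Z w.1 ?_
          rw [w.2, sieveOf_shift_vpt]
          simp
        | succ n =>
          have hn : w.1.dom (vpt (n + 1 : ℕ)) := hw _ (by simp)
          refine ext_of_total (t := (u.map (iterMap hA.toPreAdmissible h0 m n).hom).map
            (iterMap hA.toPreAdmissible h0 n m).hom) ((restrict_dom_id hM _ _).2 hn) hu ?_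
          rw [restrict_val_id hM _ _ _ hn]
          exact (hwx n hn).trans (hvn n)
    · obtain rfl : u = botSection h0 Z (site S).star :=
        eq_botSection_of_points hA h0 Z u fun p hp => hu (dom_id_of_dom (site S) hp)
      refine ⟨botSection h0 Z vert, restrict_botSection hA h0 Z _, fun n => ?_⟩
      rw [restrict_botSection hA h0 Z]
      symm
      cases n with
      | zero => rfl
      | succ n =>
        exact (congrArg (PartialSection.map _) (map_botSection h0
          (iterMap hA.toPreAdmissible h0 m n) _)).trans (map_botSection h0 _ _)

/-- The paths of the components of `u` form a section of the limit. Their compatibility is checked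
at the points of `V`, which suffices as the iterates are separated by points. -/
theorem exists_omegaBar_vert (hA : Admissible (site S) (adm S M))
    (h0 : ∀ X, adm S M ((site S).zeroInitial.to X))
    (u : (omegaBar hA.toPreAdmissible).obj.obj (op (site S).star)) :
    ∃ w : (omegaBar hA.toPreAdmissible).obj.obj (op vert),
      (omegaBar hA.toPreAdmissible).obj.map (vpt ⊤).op w = u ∧
      ∀ n : ℕ, (omegaBar hA.toPreAdmissible).obj.map (vpt n).op w =
        (omegaBarπ hA.toPreAdmissible n ≫ toOmegaBar hA.toPreAdmissible h0 n).hom.app _ u := by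
  have hM := hA.toPreAdmissible
  choose w hw hwn using fun m => exists_iter_vert hA h0 m ((omegaBarπ hM m).hom.app _ u)
  have happ : ∀ {X Y Z : Sheaf (site S).cov.toGrothendieck (Type u)} (f : X ⟶ Y) (g : Y ⟶ Z)
      {c : Comb S} (x : X.obj.obj (op c)), (f ≫ g).hom.app _ x = g.hom.app _ (f.hom.app _ x) :=
    fun _ _ _ _ => rfl
  obtain ⟨v, hv⟩ := exists_limit_section (down hM) w (by
    intro m
    refine separatedByPoints_iter hA m _ _ fun p => ?_
    obtain ⟨x, rfl⟩ := vpt_surjective p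
    rw [← NatTrans.naturality_apply]
    induction x using ENat.recTopCoe with
    | top =>
      rw [hw, hw, ← happ, omegaBarπ_down]
    | coe n =>
      rw [hwn, hwn, ← happ, ← happ, ← happ, ← omegaBarπ_down hM m, Category.assoc, Category.assoc,
        iterMap_down, down_iterMap_iterMap])
  refine ⟨v, limit_section_ext _ ?_, fun n => limit_section_ext _ ?_⟩
  · rintro ⟨m⟩
    refine (NatTrans.naturality_apply _ _ _).trans ?_
    rw [hv]
    exact hw m
  · rintro ⟨m⟩
    refine (NatTrans.naturality_apply _ _ _).trans ?_
    rw [hv]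
    refine (hwn m n).trans ?_
    have h : omegaBarπ hM m ≫ iterMap hM h0 m n ≫ iterMap hM h0 n m =
        (omegaBarπ hM n ≫ toOmegaBar hM h0 n) ≫ omegaBarπ hM m := by
      rw [Category.assoc, toOmegaBar_omegaBarπ]
      rcases le_total n m with h | h
      · rw [← Category.assoc, omegaBarπ_iterMap hM h0 h]
      · rw [iterMap_comp hM h0 (Or.inl h), iterMap_self, omegaBarπ_iterMap hM h0 h,
          Category.comp_id]
    rw [← happ, h]
    rfl

end Comb

/-! ### Local sections of the natural numbers sheaf -/

section NatSheaf

variable {C : Type u} [SmallCategory C]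

/-- The natural numbers as global elements of `natSheaf S`. -/
noncomputable def natι (S : ConcreteSite C) (n : ℕ) :
    (⊤_ (Sheaf S.cov.toGrothendieck (Type u))) ⟶ natSheaf S :=
  Sigma.ι (fun _ : ℕ => ⊤_ (Sheaf S.cov.toGrothendieck (Type u))) n

theorem exists_natSheaf_local {S : ConcreteSite C} {c : C} (s : (natSheaf S).obj.obj (op c)) :
    ∃ R ∈ S.cov.toGrothendieck c, ∀ ⦃d : C⦄ (f : d ⟶ c), R f →
      ∃ n x, (natι S n).hom.app (op d) x = (natSheaf S).obj.map f.op s := by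
  obtain ⟨R, hR, h⟩ := exists_local_section
    (Discrete.functor fun _ : ℕ => ⊤_ (Sheaf S.cov.toGrothendieck (Type u))) s
  refine ⟨R, hR, fun d f hf => ?_⟩
  obtain ⟨n, x, hx⟩ := h f hf
  exact ⟨n.as, x, hx⟩

end NatSheaf

/-! ### Completeness of liftings over the combined site -/

namespace Comb

variable {C : Type u} [SmallCategory C] {S : ConcreteSite C} {M : MorphismProperty C}

/-- The path in `ω̄` is paired with the constant path in `A`, which matches the identity on `A` in
the truncation. -/
theorem exists_prod_vert (hA : Admissible (site S) (adm S M))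
    (h0 : ∀ X, adm S M ((site S).zeroInitial.to X)) (A : Sheaf (site S).cov.toGrothendieck (Type u))
    (z : (omegaBar hA.toPreAdmissible ⨯ A).obj.obj (op (site S).star)) :
    ∃ w : (omegaBar hA.toPreAdmissible ⨯ A).obj.obj (op vert),
      (omegaBar hA.toPreAdmissible ⨯ A).obj.map (vpt ⊤).op w = z ∧
      ∀ n : ℕ, (omegaBar hA.toPreAdmissible ⨯ A).obj.map (vpt n).op w =
        (prod.map (omegaBarπ hA.toPreAdmissible n ≫ toOmegaBar hA.toPreAdmissible h0 n)
          (𝟙 A)).hom.app _ z := by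
  have hM := hA.toPreAdmissible
  let fst : omegaBar hM ⨯ A ⟶ omegaBar hM := prod.fst
  let snd : omegaBar hM ⨯ A ⟶ A := prod.snd
  obtain ⟨u, hu, hun⟩ := exists_omegaBar_vert hA h0 (fst.hom.app _ z)
  obtain ⟨w, hw1, hw2⟩ := exists_pair (omegaBar hM) A u
    (A.obj.map ((site S).starTerminal.from vert).op (snd.hom.app _ z))
  have hw2' : ∀ x, A.obj.map (vpt x).op (snd.hom.app _ w) = snd.hom.app _ z := by
    intro x
    refine (congrArg _ hw2).trans ?_
    rw [← Functor.map_comp_apply, ← op_comp,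
      (site S).starTerminal.hom_ext (vpt x ≫ (site S).starTerminal.from vert) (𝟙 _)]
    exact ConcreteCategory.congr_hom (A.obj.map_id _) _
  have happ : ∀ {X Y Z : Sheaf (site S).cov.toGrothendieck (Type u)} (f : X ⟶ Y) (g : Y ⟶ Z)
      {c : Comb S} (x : X.obj.obj (op c)), g.hom.app _ (f.hom.app _ x) = (f ≫ g).hom.app _ x :=
    fun _ _ _ _ => rfl
  refine ⟨w, pair_ext ?_ ?_, fun n => pair_ext ?_ ?_⟩
  · refine (NatTrans.naturality_apply fst.hom _ _).trans (Eq.trans ?_ hu)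
    exact congrArg _ hw1
  · exact (NatTrans.naturality_apply snd.hom _ _).trans (hw2' _)
  · refine (NatTrans.naturality_apply fst.hom _ _).trans ((congrArg _ hw1).trans ?_)
    rw [hun, happ, happ, prod.map_fst]
  · refine (NatTrans.naturality_apply snd.hom _ _).trans ((hw2' _).trans ?_)
    rw [happ, prod.map_snd, Category.comp_id]

/-- This isolates what is used of `L X`: separation makes pointwise definitions natural, flatness
over `V` controls values along paths, and flat limits supply the extension. -/
theorem isLComplete (hA : Admissible (site S) (adm S M))
    (h0 : ∀ X, adm S M ((site S).zeroInitial.to X)) (X : Sheaf (site S).cov.toGrothendieck (Type u))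
    (b : X.obj.obj (op (site S).star)) (hsep : SeparatedByPoints (site S) X.obj)
    (hflat : FlatOnVert S X.obj b) (hlim : HasFlatLimits (site S) X.obj b) :
    IsLComplete hA.toPreAdmissible h0 X := by
  have hM := hA.toPreAdmissible
  have happ : ∀ {X Y Z : Sheaf (site S).cov.toGrothendieck (Type u)} (f : X ⟶ Y) (g : Y ⟶ Z)
      {c : Comb S} (x : X.obj.obj (op c)), g.hom.app _ (f.hom.app _ x) = (f ≫ g).hom.app _ x :=
    fun _ _ _ _ => rfl
  intro A g
  let i := prod.map (comparison hM h0) (𝟙 A)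
  let τ : ∀ n, omegaBar hM ⨯ A ⟶ omega hM h0 ⨯ A := fun n =>
    prod.map (omegaBarπ hM n ≫ omegaι hM h0 n) (𝟙 A)
  let t : ∀ n, omegaBar hM ⨯ A ⟶ omegaBar hM ⨯ A := fun n =>
    prod.map (omegaBarπ hM n ≫ toOmegaBar hM h0 n) (𝟙 A)
  have hτi : ∀ n, τ n ≫ i = t n := fun n => by
    simp only [τ, i, t, prod.map_map, Category.assoc, omegaι_comparison, Category.comp_id]
  have htτ : ∀ n m, n ≤ m → t n ≫ τ m = τ n := fun n m h => by
    have : (omegaBarπ hM n ≫ toOmegaBar hM h0 n) ≫ omegaBarπ hM m ≫ omegaι hM h0 m =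
        omegaBarπ hM n ≫ omegaι hM h0 n := by
      rw [Category.assoc, ← Category.assoc (toOmegaBar hM h0 n), toOmegaBar_omegaBarπ,
        iterMap_omegaι hM h0 h]
    simp only [τ, t, prod.map_map, this, Category.comp_id]
  -- The image of the path of `z` under `g ∘ τₙ₊₁` has the value `g (τₘ z)` at each `m ≤ n + 1`. If
  -- its value at `n` is not `b`, its threshold is at most `n`, so its values at `n` and `n + 1`
  -- both equal that at infinity.
  have hinc : ∀ (z : (omegaBar hM ⨯ A).obj.obj (op (site S).star)) (n : ℕ),
      (τ n ≫ g).hom.app _ z ≠ b → (τ (n + 1) ≫ g).hom.app _ z = (τ n ≫ g).hom.app _ z := by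
    intro z n hn
    obtain ⟨w, -, hwn⟩ := exists_prod_vert hA h0 A z
    obtain ⟨k, hk⟩ := hflat ((τ (n + 1) ≫ g).hom.app _ w)
    have h1 : ∀ m, m ≤ n + 1 → X.obj.map (vpt m).op ((τ (n + 1) ≫ g).hom.app _ w) =
        (τ m ≫ g).hom.app _ z := by
      intro m hm
      refine (NatTrans.naturality_apply _ _ _).symm.trans ?_
      rw [hwn, happ, ← Category.assoc]
      change ((t m ≫ τ (n + 1)) ≫ g).hom.app _ z = _
      rw [htτ m (n + 1) hm]
    have hkn : k ≤ n := by
      by_contra! h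
      exact hn ((h1 n n.le_succ).symm.trans ((hk n).1 h))
    rw [← h1 n n.le_succ, ← h1 (n + 1) le_rfl, (hk n).2 hkn, (hk (n + 1)).2 (by omega)]
  have hex : ∀ (c : Comb S) (z : (omegaBar hM ⨯ A).obj.obj (op c)), ∃ s : X.obj.obj (op c),
      ∀ p : (site S).star ⟶ c, ∃ k, ∀ n, k ≤ n →
        X.obj.map p.op s = X.obj.map p.op ((τ n ≫ g).hom.app _ z) := fun c z =>
    hlim c (fun n => (τ n ≫ g).hom.app _ z) fun n p => by
      rw [← NatTrans.naturality_apply, ← NatTrans.naturality_apply]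
      exact hinc _ n
  choose h hh using hex
  refine existsUnique_of_exists_of_unique
    ⟨⟨{ app := fun c => ↾ h c.unop, naturality := ?_ }⟩, ?_⟩ ?_
  · intro c d f
    apply ConcreteCategory.hom_ext
    intro z
    refine hsep _ _ fun p => ?_
    change X.obj.map p.op (h d.unop _) = X.obj.map p.op (X.obj.map f (h c.unop z))
    -- Both sides agree at `p` with late members of the same chain, and an index beyond both
    -- thresholds compares them.
    obtain ⟨k, hk⟩ := hh d.unop ((omegaBar hM ⨯ A).obj.map f z) p
    obtain ⟨l, hl⟩ := hh c.unop z (p ≫ f.unop)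
    have h1 := hl (max k l) (le_max_right _ _)
    rw [op_comp, Functor.map_comp_apply, Functor.map_comp_apply] at h1
    refine (hk (max k l) (le_max_left _ _)).trans (Eq.trans ?_ h1.symm)
    exact congrArg _ (NatTrans.naturality_apply _ _ _)
  · apply Sheaf.hom_ext
    ext c z
    refine hsep _ _ fun p => ?_
    change X.obj.map p.op (h c.unop (i.hom.app _ z)) = X.obj.map p.op (g.hom.app _ z)
    obtain ⟨k, hk⟩ := hh c.unop (i.hom.app _ z) p
    obtain ⟨m, u, hu⟩ := exists_omega_star hM h0
      ((prod.fst : omega hM h0 ⨯ A ⟶ _).hom.app _ ((omega hM h0 ⨯ A).obj.map p.op z))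
    rw [hk (max k m) (le_max_left _ _), ← NatTrans.naturality_apply, ← NatTrans.naturality_apply,
      ← NatTrans.naturality_apply]
    set y := (omega hM h0 ⨯ A).obj.map p.op z
    -- The first component of `y` comes from `Lᵐ1`, so truncation at `n ≥ m` does not change it.
    have h2 : ∀ n, m ≤ n → (i ≫ τ n).hom.app _ y = y := by
      intro n hn
      refine pair_ext ?_ ?_
      · rw [happ, Category.assoc, prod.map_fst, prod.map_fst_assoc, ← happ, ← hu, happ,
          ← Category.assoc, omegaι_comparison, ← Category.assoc, toOmegaBar_omegaBarπ, iterMap_omegaι hM h0 hn]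
      · rw [happ, Category.assoc, prod.map_snd, prod.map_snd_assoc, Category.comp_id,
          Category.comp_id]
    exact congrArg _ (h2 _ (le_max_right _ _))
  · intro h₁ h₂ hh₁ hh₂
    apply Sheaf.hom_ext
    ext c z
    refine hsep _ _ fun p => ?_
    change X.obj.map p.op (h₁.hom.app _ z) = X.obj.map p.op (h₂.hom.app _ z)
    rw [← NatTrans.naturality_apply, ← NatTrans.naturality_apply]
    -- The point is the value at infinity of its path. Beyond both thresholds, flatness replaces
    -- infinity by a finite index, where the path lies in the image of `i` and both extensions
    -- restrict to `g`.
    obtain ⟨w, hw, hwn⟩ := exists_prod_vert hA h0 A ((omegaBar hM ⨯ A).obj.map p.op z)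
    obtain ⟨k, hk⟩ := hflat (h₁.hom.app _ w)
    obtain ⟨l, hl⟩ := hflat (h₂.hom.app _ w)
    rw [← hw, NatTrans.naturality_apply, NatTrans.naturality_apply,
      ← (hk (max k l)).2 (le_max_left _ _), ← (hl (max k l)).2 (le_max_right _ _),
      ← NatTrans.naturality_apply, ← NatTrans.naturality_apply, hwn]
    have hφ : t (max k l) ≫ h₁ = t (max k l) ≫ h₂ := by
      rw [← hτi, Category.assoc, Category.assoc, hh₁, hh₂]
    have hφ' := ConcreteCategory.congr_hom (NatTrans.congr_app (congrArg (·.hom) hφ)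
      (op (site S).star)) ((omegaBar hM ⨯ A).obj.map p.op z)
    exact hφ'

theorem isLComplete_lift (hA : Admissible (site S) (adm S M))
    (h0 : ∀ X, adm S M ((site S).zeroInitial.to X)) (X : Sheaf (site S).cov.toGrothendieck (Type u))
    (hsep : SeparatedByPoints (site S) X.obj) (hconst : ConstantOnVert S X.obj) :
    IsLComplete hA.toPreAdmissible h0 ((lift hA.toPreAdmissible).obj X) :=
  isLComplete hA h0 _ (botSection h0 X (site S).star) (hsep.liftPresheaf hA)
    (flatOnVert_liftPresheaf hA h0 X hconst) (hasFlatLimits_liftPresheaf hA h0 X hsep)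

theorem constantOnVert_terminal :
    ConstantOnVert S (⊤_ (Sheaf (site S).cov.toGrothendieck (Type u))).obj := by
  intro s
  obtain ⟨t⟩ := nonempty_terminal_section (J := (site S).cov.toGrothendieck) (site S).star
  exact ⟨t, subsingleton_terminal_section _ _⟩

/-- A section is locally a natural number, and every covering sieve of `V` contains the identity, so
over `V` it is one globally. -/
theorem constantOnVert_natSheaf : ConstantOnVert S (natSheaf (site S)).obj := by
  intro s
  obtain ⟨R, hR, h⟩ := exists_natSheaf_local s
  obtain ⟨n, u, hu⟩ := h (𝟙 _) (mem_of_mem_toGrothendieck_vert hR (𝟙 _))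
  obtain ⟨t⟩ := nonempty_terminal_section (J := (site S).cov.toGrothendieck) (site S).star
  refine ⟨(natι (site S) n).hom.app _ t, ?_⟩
  rw [← NatTrans.naturality_apply]
  refine (ConcreteCategory.congr_hom ((natSheaf (site S)).obj.map_id _) s).symm.trans
    (hu.symm.trans ?_)
  exact congrArg _ (subsingleton_terminal_section u _)

end Comb

/-! ### The sheaf of natural numbers and the dominance -/

section Natural

variable {C : Type u} [SmallCategory C] {S : ConcreteSite C} {M : MorphismProperty C}

/-- Pass to a common cover on which both sections are natural numbers. On a piece with a point, such
a section is pulled back from its value there; a piece without points maps to `0`, over which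
sections are unique. -/
theorem separatedByPoints_natSheaf (hM : Admissible S M) :
    SeparatedByPoints S (natSheaf S).obj := by
  intro c s t h
  have hsep := (isSheaf_iff_isSheaf_of_type _ _).1 (natSheaf S).property
  obtain ⟨R, hR, hs⟩ := exists_natSheaf_local s
  obtain ⟨T, hT, ht⟩ := exists_natSheaf_local t
  refine (hsep _ (S.cov.toGrothendieck.intersection_covering hR hT)).isSeparatedFor.ext ?_
  rintro d f ⟨hf, hf'⟩
  by_cases hd : Nonempty (S.star ⟶ d)
  · obtain ⟨p⟩ := hd
    -- The restriction of `s` to `d` comes from a section of `1`, so it is recovered from its value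
    -- at the one point `p` by restriction along `d ⟶ star`.
    have key : ∀ s : (natSheaf S).obj.obj (op c),
        (∃ n x, (natι S n).hom.app _ x = (natSheaf S).obj.map f.op s) →
        (natSheaf S).obj.map f.op s = (natSheaf S).obj.map (S.starTerminal.from d).op
          ((natSheaf S).obj.map (p ≫ f).op s) := by
      rintro s ⟨n, x, hx⟩
      rw [op_comp, Functor.map_comp_apply, ← hx, ← NatTrans.naturality_apply,
        ← NatTrans.naturality_apply]
      exact congrArg _ (subsingleton_terminal_section _ _)
    rw [key s (hs f hf), key t (ht f hf'), h]
  · obtain ⟨k⟩ := nonempty_hom_zero hM fun p => hd ⟨p⟩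
    obtain ⟨e⟩ := S.exists_unique_section k (natSheaf S)
    exact (e.eq_default _).trans (e.eq_default _).symm

/-- The dominance is the lifting of the terminal object. -/
noncomputable def deltaIso (hM : PreAdmissible S.cov M) :
    deltaSheaf hM ≅ (lift hM).obj (⊤_ _) where
  hom := ⟨{ app := fun c => ↾ fun U =>
              { dom := U.1
                isSub := U.2
                val := fun d _ _ => (nonempty_terminal_section d).some
                compat := fun _ _ _ _ _ => subsingleton_terminal_section _ _ }
            naturality := by
              intro c d f
              apply ConcreteCategory.hom_ext
              intro U
              exact PartialSection.ext' rfl fun _ _ _ _ => subsingleton_terminal_section _ _ }⟩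
  inv := ⟨{ app := fun c => ↾ fun s => ⟨PartialSection.dom s, PartialSection.isSub s⟩
            naturality := by
              intro c d f
              rfl }⟩
  hom_inv_id := rfl
  inv_hom_id := by
    apply Sheaf.hom_ext
    ext c s
    exact PartialSection.ext' rfl fun _ _ _ _ => subsingleton_terminal_section _ _

theorem IsLComplete.of_iso {hM : PreAdmissible S.cov M} {h0 : ∀ c : C, M (S.zeroInitial.to c)}
    {X Y : Sheaf S.cov.toGrothendieck (Type u)} (hX : IsLComplete hM h0 X) (e : Y ≅ X) :
    IsLComplete hM h0 Y := by
  intro A g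
  obtain ⟨h, hh, hu⟩ := hX A (g ≫ e.hom)
  refine ⟨h ≫ e.inv, ?_, fun k hk => ?_⟩
  · change prod.map (comparison hM h0) (𝟙 A) ≫ h ≫ e.inv = g
    rw [reassoc_of% hh, e.hom_inv_id, Category.comp_id]
  · rw [← hu (k ≫ e.hom) (by rw [← hk, Category.assoc]), Category.assoc, e.hom_inv_id,
      Category.comp_id]

end Natural

end SDT

theorem mainTheorem4 {C : Type u} [SmallCategory C] (S : SDT.ConcreteSite C)
    (M : MorphismProperty C) (hM : SDT.Admissible S M) :
    SDT.IsLComplete (S := SDT.Comb.site S) (M := SDT.Comb.adm S M)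
        (SDT.Comb.adm_preAdmissible hM) (SDT.Comb.adm_zero hM)
        (SDT.deltaSheaf (SDT.Comb.adm_preAdmissible hM)) ∧
      SDT.IsLComplete (S := SDT.Comb.site S) (M := SDT.Comb.adm S M)
        (SDT.Comb.adm_preAdmissible hM) (SDT.Comb.adm_zero hM)
        ((SDT.lift (SDT.Comb.adm_preAdmissible hM)).obj (SDT.natSheaf (SDT.Comb.site S))) := by
  have hA := SDT.Comb.site_admissible hM
  constructor
  · exact (SDT.Comb.isLComplete_lift hA (SDT.Comb.adm_zero hM) _
      (fun _ s t _ => SDT.subsingleton_terminal_section s t)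
      SDT.Comb.constantOnVert_terminal).of_iso (SDT.deltaIso _)
  · exact SDT.Comb.isLComplete_lift hA (SDT.Comb.adm_zero hM) _
      (SDT.separatedByPoints_natSheaf hA) SDT.Comb.constantOnVert_natSheaf
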